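/- **Setting (online linear optimization).** Let $K\subset\mathbb R^d$ be compact and convex with $\|w\|_2\le D$ for all $w\in K$. In each round $t=1,\dots,T$ the learner receives a prediction $m_t\in\mathbb R^d$, decides $w_t\in K$, and then receives $\ell_t\in\mathbb R^d$, where $\|\ell_t-m_t\|_2\le 1$. Let $\mathrm{Reg}(u)=\sum_{t=1}^T\langle w_t-u,\ell_t\rangle$, and let $D_\psi(u,w)=\psi(u)-\psi(w)-\langle\nabla\psi(w),u-w\rangle$ denote the Bregman divergence. **Base algorithm** $\mathcal A$ with learning rate $\eta$. Start with $w_1'=0$. In round $t$, with $A_t=\eta\big(8I+\sum_{s<t}(\nabla_s-m_s)(\nabla_s-m_s)^\top\big)$ and $\psi_t(w)=\frac12 w^\top A_t w$, decide $w_t^{\mathcal A}=\arg\min_{w\in K}\{\langle w,m_t\rangle+D_{\psi_t}(w,w_t')\}$. After receiving $\ell_t$ and a point $\bar w_t$, let $c_t(w)=\langle w,\ell_t\rangle+16\eta\langle w-\bar w_t,\ell_t-m_t\rangle^2$, $\nabla_t=\nabla c_t(w_t^{\mathcal A})$, and $w_{t+1}'=\arg\min_{w\in K}\{\langle w,\nabla_t\rangle+D_{\psi_t}(w,w_t')\}$.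 **Experts.** For $k=1,\dots,N=\lceil\log_2(2DT)\rceil$ let $\eta_k=\frac1{64D\,2^k}$, and let $\mathcal A_k$ be the base algorithm with learning rate $4\eta_k$ and with $\bar w_t=w_t$, the decision of the master. **Master (MsMwC-Master with modified $h_t$).** Let $\Delta$ be the probability simplex over the $N$ experts, $\psi(p)=\sum_k\frac{1}{\eta_k}p_k\ln p_k$, and $p'_{1,k}=\eta_k^2/\sum_j\eta_j^2$. In round $t$, let $w_t^k$ be the decision of $\mathcal A_k$, $h'_{t,k}=\langle w_t^k,m_t\rangle$, $g_{t,k}=\langle w_t^k,\ell_t\rangle$, $h_{t,k}=h'_{t,k}+\langle p_t,g_t-h'_t\rangle$ and $b_{t,k}=32\eta_k(g_{t,k}-h_{t,k})^2$. Here $p_t=\arg\min_{p\in\Delta}\{\langle p,h_t\rangle+D_\psi(p,p_t')\}$, which can be computed before $\ell_t$ is known because $h_t$ and $h'_t$ differ by a multiple of the all-one vector and so give the same minimizer over $\Delta$. The master decides $w_t=\sum_k p_{t,k}w_t^k$ and sets $p'_{t+1}=\arg\min_{p\in\Delta}\{\langle p,g_t+b_t\rangle+D_\psi(p,p'_t)\}$.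 **Theorem.** There is a universal constant $C>0$ such that for all $d,T,D,K$ and all sequences $(m_t),(\ell_t)$ as above with $D\sqrt T\ge1$ and with $r:=\operatorname{rank}\sum_{t=1}^T(\ell_t-m_t)(\ell_t-m_t)^\top\ge 1$, the algorithm ensures for all $u\in K$ $$\mathrm{Reg}(u)\le C(1+\ln T)\Big(rD+\sqrt{r\sum_{t=1}^T\langle u-w_t,\ell_t-m_t\rangle^2}\Big).$$ -/

import Mathlib

open scoped Gradient

noncomputable section

namespace OLO

/-- A minimizer of `f` over `S` (arbitrary if there is none). -/
def argminOn {E : Type*} [Nonempty E] (f : E → ℝ) (S : Set E) : E :=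
  Classical.epsilon fun x => x ∈ S ∧ IsMinOn f S x

/-- The Bregman divergence `D_ψ(u, w) = ψ(u) - ψ(w) - ⟨∇ψ(w), u - w⟩`. -/
def bregman {E : Type*} [NormedAddCommGroup E] [NormedSpace ℝ E] (ψ : E → ℝ) (u w : E) : ℝ :=
  ψ u - ψ w - fderiv ℝ ψ w (u - w)

/-- The outer product `v vᵀ`. -/
def outer {d : ℕ} (v : EuclideanSpace ℝ (Fin d)) : Matrix (Fin d) (Fin d) ℝ :=
  Matrix.vecMulVec (fun i => v i) (fun i => v i)

/-- The quadratic regularizer `w ↦ (1/2) wᵀ A w`. -/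
def quadReg {d : ℕ} (A : Matrix (Fin d) (Fin d) ℝ) (w : EuclideanSpace ℝ (Fin d)) : ℝ :=
  1 / 2 * ((fun i => w i) ⬝ᵥ A.mulVec (fun i => w i))

/-- The weighted negative entropy `p ↦ ∑ₖ (pₖ / ηₖ) ln pₖ`. -/
def weightedEntropy {N : ℕ} (η : Fin N → ℝ) (p : Fin N → ℝ) : ℝ :=
  ∑ k, p k / η k * Real.log (p k)

/-! ### Base algorithms and experts -/

/-- A deterministic base algorithm.  In every round it receives the prediction `mₜ` and decides;
afterwards it receives the loss `ℓₜ` and a reference point `w̄ₜ` and updates its state. -/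
structure BaseAlg (V : Type) where
  State : Type
  init : State
  /-- state, `mₜ` ↦ decision -/
  decide : State → V → V
  /-- state, `mₜ`, `ℓₜ`, `w̄ₜ` ↦ next state -/
  update : State → V → V → V → State

/-- An expert `(ηₖ, 𝒜ₖ)` of the master. -/
structure Expert (V : Type) where
  rate : ℝ
  alg : BaseAlg V

/-! ### The MetaGrad base algorithm -/

section MetaGrad

variable {d : ℕ}

/-- The surrogate loss `c(w) = ⟨w, ℓ⟩ + 16 η ⟨w - w̄, ℓ - m⟩²`. -/
def surrogate (η : ℝ) (m ℓ wbar w : EuclideanSpace ℝ (Fin d)) : ℝ :=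
  inner ℝ w ℓ + 16 * η * inner ℝ (w - wbar) (ℓ - m) ^ 2

/-- At the beginning of round `t`: `center` is `w'ₜ`, and `gram` is
`∑_{s < t} (∇ₛ - mₛ)(∇ₛ - mₛ)ᵀ`. -/
structure MetaGradState (d : ℕ) where
  center : EuclideanSpace ℝ (Fin d)
  gram : Matrix (Fin d) (Fin d) ℝ

/-- `ψₜ(w) = (1/2) ‖w‖²_{Aₜ}` with `Aₜ = η (8 I + ∑_{s < t} (∇ₛ - mₛ)(∇ₛ - mₛ)ᵀ)`. -/
def MetaGradState.reg (η : ℝ) (s : MetaGradState d) : EuclideanSpace ℝ (Fin d) → ℝ :=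
  quadReg (η • ((8 : ℝ) • (1 : Matrix (Fin d) (Fin d) ℝ) + s.gram))

/-- `wₜ = argmin_{w ∈ K} ⟨w, mₜ⟩ + D_{ψₜ}(w, w'ₜ)`. -/
def MetaGradState.decide (K : Set (EuclideanSpace ℝ (Fin d))) (η : ℝ) (s : MetaGradState d)
    (m : EuclideanSpace ℝ (Fin d)) : EuclideanSpace ℝ (Fin d) :=
  argminOn (fun w => inner ℝ w m + bregman (s.reg η) w s.center) K

/-- `∇ₜ = ∇cₜ(wₜ)`, the gradient of the surrogate loss at the algorithm's own decision. -/
def MetaGradState.grad (K : Set (EuclideanSpace ℝ (Fin d))) (η : ℝ) (s : MetaGradState d)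
    (m ℓ wbar : EuclideanSpace ℝ (Fin d)) : EuclideanSpace ℝ (Fin d) :=
  ∇ (surrogate η m ℓ wbar) (s.decide K η m)

/-- `w'ₜ₊₁ = argmin_{w ∈ K} ⟨w, ∇ₜ⟩ + D_{ψₜ}(w, w'ₜ)`, and `∇ₜ - mₜ` enters the matrix. -/
def MetaGradState.update (K : Set (EuclideanSpace ℝ (Fin d))) (η : ℝ) (s : MetaGradState d)
    (m ℓ wbar : EuclideanSpace ℝ (Fin d)) : MetaGradState d where
  center := argminOn
    (fun w => inner ℝ w (s.grad K η m ℓ wbar) + bregman (s.reg η) w s.center) K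
  gram := s.gram + outer (s.grad K η m ℓ wbar - m)

/-- The MetaGrad base algorithm with decision set `K` and learning rate `η`, started at
`w'₁ = 0`. -/
def metaGrad (K : Set (EuclideanSpace ℝ (Fin d))) (η : ℝ) :
    BaseAlg (EuclideanSpace ℝ (Fin d)) where
  State := MetaGradState d
  init := ⟨0, 0⟩
  decide := fun s m => s.decide K η m
  update := fun s m ℓ wbar => s.update K η m ℓ wbar

/-- The number `⌈log₂ (2 D T)⌉` of experts. -/
def numExperts (D : ℝ) (T : ℕ) : ℕ := ⌈Real.logb 2 (2 * D * T)⌉₊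

/-- The expert set: for `k = 1, …, ⌈log₂ (2 D T)⌉` the rate `ηₖ = 1 / (64 D 2ᵏ)` together with
the MetaGrad base algorithm with learning rate `4 ηₖ`. -/
def expertSet (K : Set (EuclideanSpace ℝ (Fin d))) (D : ℝ) (T : ℕ) (k : Fin (numExperts D T)) :
    Expert (EuclideanSpace ℝ (Fin d)) where
  rate := 1 / (64 * D * 2 ^ (k.val + 1))
  alg := metaGrad K (4 * (1 / (64 * D * 2 ^ (k.val + 1))))

end MetaGrad

/-! ### The master -/

section Master

variable {V : Type} [NormedAddCommGroup V] [InnerProductSpace ℝ V] {N : ℕ}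

/-- At the beginning of round `t`: `prior` is `p'ₜ`, and `base k` is the state of the `k`-th base
algorithm. -/
structure MasterState (𝓔 : Fin N → Expert V) where
  prior : Fin N → ℝ
  base : ∀ k, (𝓔 k).alg.State

variable {𝓔 : Fin N → Expert V}

/-- The initial state, with `p'₁,ₖ ∝ ηₖ²`. -/
def MasterState.init (𝓔 : Fin N → Expert V) : MasterState 𝓔 where
  prior := fun k => (𝓔 k).rate ^ 2 / ∑ j, (𝓔 j).rate ^ 2
  base := fun k => (𝓔 k).alg.init

/-- The objective `⟨p, x⟩ + D_ψ(p, p'ₜ)`, where `ψ(p) = ∑ₖ (pₖ / ηₖ) ln pₖ`. -/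
def MasterState.objective (s : MasterState 𝓔) (x p : Fin N → ℝ) : ℝ :=
  ∑ k, p k * x k + bregman (weightedEntropy fun k => (𝓔 k).rate) p s.prior

/-- The decision `wₜᵏ` of the `k`-th base algorithm. -/
def MasterState.baseDecision (s : MasterState 𝓔) (m : V) (k : Fin N) : V :=
  (𝓔 k).alg.decide (s.base k) m

/-- `h'ₜ,ₖ = ⟨wₜᵏ, mₜ⟩`. -/
def MasterState.hint (s : MasterState 𝓔) (m : V) (k : Fin N) : ℝ :=
  inner ℝ (s.baseDecision m k) m

/-- `pₜ = argmin_{p ∈ Λₜ} ⟨p, hₜ⟩ + D_ψ(p, p'ₜ)`.  It is computed from `h'ₜ`: the two vectors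
`hₜ` and `h'ₜ` differ by a multiple of the all-one vector, so that both give the same `pₜ`
when `Λₜ` is contained in the simplex, see `MasterState.weights_eq`. -/
def MasterState.weights (Λ : Set (Fin N → ℝ)) (s : MasterState 𝓔) (m : V) : Fin N → ℝ :=
  argminOn (s.objective (s.hint m)) Λ

/-- The master's decision `wₜ = ∑ₖ pₜ,ₖ wₜᵏ`. -/
def MasterState.decide (Λ : Set (Fin N → ℝ)) (s : MasterState 𝓔) (m : V) : V :=
  ∑ k, s.weights Λ m k • s.baseDecision m k

/-- `gₜ,ₖ = ⟨wₜᵏ, ℓₜ⟩`. -/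
def MasterState.baseLoss (s : MasterState 𝓔) (m ℓ : V) (k : Fin N) : ℝ :=
  inner ℝ (s.baseDecision m k) ℓ

/-- The modified prediction `hₜ,ₖ = h'ₜ,ₖ + ⟨pₜ, gₜ - h'ₜ⟩`. -/
def MasterState.modHint (Λ : Set (Fin N → ℝ)) (s : MasterState 𝓔) (m ℓ : V) (k : Fin N) : ℝ :=
  s.hint m k + ∑ j, s.weights Λ m j * (s.baseLoss m ℓ j - s.hint m j)

/-- The correction term `bₜ,ₖ = 32 ηₖ (gₜ,ₖ - hₜ,ₖ)²`. -/
def MasterState.correction (Λ : Set (Fin N → ℝ)) (s : MasterState 𝓔) (m ℓ : V) (k : Fin N) :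
    ℝ :=
  32 * (𝓔 k).rate * (s.baseLoss m ℓ k - s.modHint Λ m ℓ k) ^ 2

/-- `p'ₜ₊₁ = argmin_{p ∈ Λₜ} ⟨p, gₜ + bₜ⟩ + D_ψ(p, p'ₜ)`; the base algorithms receive `ℓₜ` and
the master's decision as their reference point `w̄ₜ`. -/
def MasterState.update (Λ : Set (Fin N → ℝ)) (s : MasterState 𝓔) (m ℓ : V) : MasterState 𝓔 where
  prior := argminOn (s.objective fun k => s.baseLoss m ℓ k + s.correction Λ m ℓ k) Λ
  base := fun k => (𝓔 k).alg.update (s.base k) m ℓ (s.decide Λ m)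

/-- The state of the master at the beginning of round `t` (rounds are counted from `0`). -/
def masterState (𝓔 : Fin N → Expert V) (Λ : ℕ → Set (Fin N → ℝ)) (m ℓ : ℕ → V) :
    ℕ → MasterState 𝓔
  | 0 => MasterState.init 𝓔
  | t + 1 => (masterState 𝓔 Λ m ℓ t).update (Λ t) (m t) (ℓ t)

/-- The decision `wₜ` of MsMwC-Master (with the modified `hₜ`) in round `t`. -/
def masterDecision (𝓔 : Fin N → Expert V) (Λ : ℕ → Set (Fin N → ℝ)) (m ℓ : ℕ → V) (t : ℕ) : V :=
  (masterState 𝓔 Λ m ℓ t).decide (Λ t) (m t)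

/-- The weights `pₜ` are those that the modified prediction `hₜ` yields. -/
theorem MasterState.weights_eq (Λ : Set (Fin N → ℝ)) (hΛ : Λ ⊆ stdSimplex ℝ (Fin N))
    (s : MasterState 𝓔) (m ℓ : V) :
    s.weights Λ m = argminOn (s.objective (s.modHint Λ m ℓ)) Λ := by
  have key : ∀ p ∈ Λ, s.objective (s.modHint Λ m ℓ) p = s.objective (s.hint m) p
      + ∑ j, s.weights Λ m j * (s.baseLoss m ℓ j - s.hint m j) := by
    intro p hp
    have h1 : ∑ k, p k = 1 := (hΛ hp).2
    simp only [MasterState.objective, MasterState.modHint, mul_add, Finset.sum_add_distrib]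
    rw [← Finset.sum_mul, h1]
    ring
  unfold MasterState.weights argminOn
  congr 1
  funext x
  refine propext (and_congr_right fun hx => ?_)
  simp only [isMinOn_iff]
  refine forall₂_congr fun y hy => ?_
  change _ ↔ s.objective (s.modHint Λ m ℓ) x ≤ s.objective (s.modHint Λ m ℓ) y
  rw [key x hx, key y hy, add_le_add_iff_right]

end Master

/-- `Reg(u) = ∑_{t < T} ⟨wₜ - u, ℓₜ⟩`. -/
def regret {d : ℕ} (T : ℕ) (w ℓ : ℕ → EuclideanSpace ℝ (Fin d)) (u : EuclideanSpace ℝ (Fin d)) :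
    ℝ :=
  ∑ t ∈ Finset.range T, inner ℝ (w t - u) (ℓ t)

/-- The rank of `∑_{t < T} (ℓₜ - mₜ)(ℓₜ - mₜ)ᵀ`. -/
def errorRank {d : ℕ} (T : ℕ) (m ℓ : ℕ → EuclideanSpace ℝ (Fin d)) : ℕ :=
  (∑ t ∈ Finset.range T, outer (ℓ t - m t)).rank

/-- The decisions of MsMwC-Master with the modified `hₜ`, the MetaGrad expert set for
`(K, D, T)`, and `Λₜ` the full simplex in every round. -/
def metaGradMaster {d : ℕ} (K : Set (EuclideanSpace ℝ (Fin d))) (D : ℝ) (T : ℕ)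
    (m ℓ : ℕ → EuclideanSpace ℝ (Fin d)) : ℕ → EuclideanSpace ℝ (Fin d) :=
  masterDecision (expertSet K D T) (fun _ => stdSimplex ℝ (Fin (numExperts D T))) m ℓ

end OLO

end

noncomputable section

namespace OLO

/-! ### Minimizers -/

/-! Fix an expert with rate `ηₖ = 1/(64Dy)`, `y = 2ᵏ`, and decisions `xₜ`. Put `vₜ = ℓₜ - mₜ` and
split `⟨wₜ - u, ℓₜ⟩` at `xₜ`.

Master against expert (`MasterState.round_le`): optimistic mirror descent with weighted entropy
costs the initial potential plus `32ηₖ ∑ ⟨xₜ - wₜ, vₜ⟩²`. The prediction error is centred at `wₜ`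
because of the modified hint (`MasterState.baseLoss_sub_modHint`). The prior proportional to `ηₖ²`
makes the initial potential `O(Dy log y + D)`.

Expert against `u` (`IsRun.regret_le`): the surrogate contributes `-64ηₖ ∑ ⟨xₜ - wₜ, vₜ⟩²`, which
absorbs the master's cost, and `+64ηₖ ∑ ⟨u - wₜ, vₜ⟩² = S/(Dy)`, the variance term of the theorem.
The remaining cost is an elliptical potential (`sum_invForm_le`). The gradient errors are multiples
of the `vₜ`, so it is governed by the rank `r` rather than the dimension and is `O(Dyr log T)`.

The total is `O(Dyr log T + S/(Dy) + Dy log y + D)`. The grid of rates contains a `y` balancing the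
first two terms with `y ≤ 4√T` (`exists_expert`), so no logarithm of `D` survives. -/

theorem argminOn_spec {E : Type*} [Nonempty E] {f : E → ℝ} {S : Set E}
    (h : ∃ x ∈ S, IsMinOn f S x) : argminOn f S ∈ S ∧ IsMinOn f S (argminOn f S) :=
  Classical.epsilon_spec (p := fun x => x ∈ S ∧ IsMinOn f S x) h

/-- If `a s + b s² ≥ 0` for all `s ∈ (0, 1]` then `a ≥ 0`. -/
theorem nonneg_of_forall_mul_add_sq_nonneg {a b : ℝ}
    (h : ∀ s : ℝ, 0 < s → s ≤ 1 → 0 ≤ s * a + s ^ 2 * b) : 0 ≤ a := by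
  by_contra! ha
  have hb : 0 < |b| + 1 - a := by have := abs_nonneg b; linarith
  -- Chosen so that `a + s|b| = s(a - 1)`, which is negative.
  set s : ℝ := -a / (|b| + 1 - a) with hs
  have hs0 : 0 < s := div_pos (by linarith) hb
  have hs1 : s ≤ 1 := by
    rw [hs, div_le_one hb]; have := abs_nonneg b; linarith
  have h1 := h s hs0 hs1
  have h2 : 0 ≤ s * (a + s * b) := by nlinarith
  have h3 : 0 ≤ a + s * b := nonneg_of_mul_nonneg_right h2 hs0
  have h4 : s * b ≤ s * |b| := mul_le_mul_of_nonneg_left (le_abs_self b) hs0.le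
  have h5 : s * (|b| + 1 - a) = -a := div_mul_cancel₀ _ hb.ne'
  nlinarith

/-! ### Quadratic regularizers and proximal steps -/

section Quadratic

variable {d : ℕ}

/-- The bilinear form `(x, y) ↦ xᵀ A y`. -/
def bilin (A : Matrix (Fin d) (Fin d) ℝ) (x y : EuclideanSpace ℝ (Fin d)) : ℝ :=
  x.ofLp ⬝ᵥ A.mulVec y.ofLp

variable (A B : Matrix (Fin d) (Fin d) ℝ) (x y z : EuclideanSpace ℝ (Fin d))

theorem bilin_add_left : bilin A (x + y) z = bilin A x z + bilin A y z := by
  simp [bilin, add_dotProduct]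

theorem bilin_add_right : bilin A x (y + z) = bilin A x y + bilin A x z := by
  simp [bilin, Matrix.mulVec_add, dotProduct_add]

theorem bilin_sub_left : bilin A (x - y) z = bilin A x z - bilin A y z := by
  simp [bilin, sub_dotProduct]

theorem bilin_sub_right : bilin A x (y - z) = bilin A x y - bilin A x z := by
  simp [bilin, Matrix.mulVec_sub, dotProduct_sub]

theorem bilin_smul_left (c : ℝ) : bilin A (c • x) y = c * bilin A x y := by
  simp [bilin]

theorem bilin_smul_right (c : ℝ) : bilin A x (c • y) = c * bilin A x y := by
  simp [bilin, Matrix.mulVec_smul]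

theorem bilin_add_matrix : bilin (A + B) x y = bilin A x y + bilin B x y := by
  simp [bilin, Matrix.add_mulVec, dotProduct_add]

theorem bilin_smul_matrix (c : ℝ) : bilin (c • A) x y = c * bilin A x y := by
  simp [bilin, Matrix.smul_mulVec]

theorem bilin_one : bilin 1 x y = inner ℝ x y := by
  simp [bilin, EuclideanSpace.inner_eq_star_dotProduct, dotProduct_comm]

theorem bilin_outer (v : EuclideanSpace ℝ (Fin d)) :
    bilin (outer v) x y = inner ℝ x v * inner ℝ y v := by
  simp [bilin, outer, EuclideanSpace.inner_eq_star_dotProduct, Matrix.vecMulVec_mulVec,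
    dotProduct_comm, mul_comm]

variable {A}

theorem bilin_comm (hA : A.IsSymm) : bilin A x y = bilin A y x := by
  unfold bilin
  rw [Matrix.dotProduct_mulVec, ← Matrix.mulVec_transpose, hA.eq, dotProduct_comm]

theorem quadReg_eq : quadReg A x = 1 / 2 * bilin A x x := rfl

theorem hasFDerivAt_quadReg (hA : A.IsSymm) :
    ∃ L : EuclideanSpace ℝ (Fin d) →L[ℝ] ℝ, (∀ h, L h = bilin A x h) ∧
      HasFDerivAt (quadReg A) L x := by
  let b : EuclideanSpace ℝ (Fin d) →L[ℝ] EuclideanSpace ℝ (Fin d) →L[ℝ] ℝ :=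
    LinearMap.toContinuousBilinearMap (LinearMap.mk₂ ℝ (bilin A) (bilin_add_left A)
      (fun c x y => bilin_smul_left A x y c) (bilin_add_right A)
      (fun c x y => bilin_smul_right A x y c))
  have hb : ∀ x y, b x y = bilin A x y := fun _ _ => rfl
  have h := (b.hasFDerivAt_of_bilinear (hasFDerivAt_id x) (hasFDerivAt_id x)).const_mul (1 / 2)
  refine ⟨b x, hb x, h.congr_fderiv ?_⟩
  ext1 y
  simp [hb, bilin_comm y x hA]
  ring

theorem bregman_quadReg (hA : A.IsSymm) :
    bregman (quadReg A) x y = 1 / 2 * bilin A (x - y) (x - y) := by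
  obtain ⟨L, hL, h⟩ := hasFDerivAt_quadReg y hA
  rw [bregman, h.fderiv, hL]
  simp only [quadReg_eq, bilin_sub_left, bilin_sub_right, bilin_comm x y hA]
  ring

theorem continuous_quadReg (hA : A.IsSymm) : Continuous (quadReg A) :=
  continuous_iff_continuousAt.2 fun x => (hasFDerivAt_quadReg x hA).choose_spec.2.continuousAt

/-- First order optimality of a quadratic proximal step. -/
theorem prox_quadReg {K : Set (EuclideanSpace ℝ (Fin d))} (hK : IsCompact K) (hc : Convex ℝ K)
    (hne : K.Nonempty) (hA : A.IsSymm) (g c : EuclideanSpace ℝ (Fin d)) :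
    let w := argminOn (fun w => inner ℝ w g + bregman (quadReg A) w c) K
    w ∈ K ∧ ∀ v ∈ K, 0 ≤ inner ℝ (v - w) g + bilin A (v - w) (w - c) := by
  intro w
  have hcont : Continuous fun w : EuclideanSpace ℝ (Fin d) =>
      inner ℝ w g + bregman (quadReg A) w c := by
    unfold bregman
    have := continuous_quadReg hA
    fun_prop
  obtain ⟨hw, hmin⟩ := argminOn_spec (hK.exists_isMinOn hne hcont.continuousOn)
  refine ⟨hw, fun v hv => ?_⟩
  refine nonneg_of_forall_mul_add_sq_nonneg (b := 1 / 2 * bilin A (v - w) (v - w))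
    fun s hs hs1 => ?_
  have hmem : w + s • (v - w) ∈ K := hc.add_smul_sub_mem hw hv ⟨hs.le, hs1⟩
  have h := isMinOn_iff.1 hmin _ hmem
  change inner ℝ w g + bregman (quadReg A) w c ≤ _ at h
  rw [bregman_quadReg _ _ hA, bregman_quadReg _ _ hA, inner_add_left, real_inner_smul_left,
    show w + s • (v - w) - c = (w - c) + s • (v - w) by abel] at h
  simp only [bilin_add_left (x := w - c), bilin_add_right (y := w - c), bilin_smul_left,
    bilin_smul_right, bilin_comm (w - c) (v - w) hA] at h
  linarith

theorem outer_isSymm (v : EuclideanSpace ℝ (Fin d)) : (outer v).IsSymm := by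
  ext i j
  simp [outer, Matrix.vecMulVec_apply, mul_comm]

/-! ### Elliptical potentials -/

/-- A symmetric matrix bounded below by `8 I`. -/
structure IsRegular (B : Matrix (Fin d) (Fin d) ℝ) : Prop where
  symm : B.IsSymm
  le : ∀ x, 8 * ‖x‖ ^ 2 ≤ bilin B x x

/-- `gᵀ B⁻¹ g`. -/
def invForm (B : Matrix (Fin d) (Fin d) ℝ) (g : EuclideanSpace ℝ (Fin d)) : ℝ :=
  bilin B⁻¹ g g

variable {B : Matrix (Fin d) (Fin d) ℝ}

theorem IsRegular.posDef (hB : IsRegular B) : B.PosDef := by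
  refine .of_dotProduct_mulVec_pos (by simpa [Matrix.IsHermitian] using hB.symm.eq) fun x hx => ?_
  have h := hB.le (WithLp.toLp 2 x)
  have h1 : 0 < ‖WithLp.toLp 2 x‖ := norm_pos_iff.2 (by simpa using hx)
  have : 0 < bilin B (WithLp.toLp 2 x) (WithLp.toLp 2 x) := lt_of_lt_of_le (by positivity) h
  simpa [bilin] using this

/-- The witness is `B⁻¹g`; with it, later facts about `invForm` need no manipulation of the inverse
matrix. -/
theorem IsRegular.exists_solution (hB : IsRegular B) (g : EuclideanSpace ℝ (Fin d)) :
    ∃ h, (∀ y, bilin B y h = inner ℝ y g) ∧ invForm B g = inner ℝ h g := by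
  have hu : IsUnit B.det := hB.posDef.det_pos.ne'.isUnit
  refine ⟨WithLp.toLp 2 (B⁻¹.mulVec g.ofLp), fun y => ?_, ?_⟩
  · simp [bilin, Matrix.mulVec_mulVec, Matrix.mul_nonsing_inv _ hu,
      EuclideanSpace.inner_eq_star_dotProduct, dotProduct_comm]
  · simp [bilin, invForm, EuclideanSpace.inner_eq_star_dotProduct]

theorem IsRegular.invForm_nonneg (hB : IsRegular B) (g : EuclideanSpace ℝ (Fin d)) :
    0 ≤ invForm B g := by
  obtain ⟨h, h1, h2⟩ := hB.exists_solution g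
  rw [h2, ← h1]
  exact le_trans (by positivity) (hB.le h)

/-- Cauchy–Schwarz for the norm of `B` and its dual, from the discriminant of `s ↦ ‖y - s B⁻¹g‖²_B`.
-/
theorem IsRegular.inner_sq_le (hB : IsRegular B) (y g : EuclideanSpace ℝ (Fin d)) :
    inner ℝ y g ^ 2 ≤ bilin B y y * invForm B g := by
  obtain ⟨h, h1, h2⟩ := hB.exists_solution g
  have key : ∀ s : ℝ, 0 ≤ invForm B g * (s * s) + (-2 * inner ℝ y g) * s + bilin B y y := by
    intro s
    have := le_trans (by positivity) (hB.le (y - s • h))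
    simp only [bilin_sub_left, bilin_sub_right, bilin_smul_left, bilin_smul_right,
      bilin_comm h y hB.symm, h1, inner_sub_left, real_inner_smul_left] at this
    rw [h2]
    linarith
  have := discrim_le_zero key
  unfold discrim at this
  nlinarith

theorem IsRegular.invForm_le (hB : IsRegular B) (g : EuclideanSpace ℝ (Fin d)) :
    invForm B g ≤ ‖g‖ ^ 2 / 8 := by
  obtain ⟨h, h1, h2⟩ := hB.exists_solution g
  have h3 := hB.le h
  rw [h1, ← h2] at h3
  have h4 : invForm B g ≤ ‖h‖ * ‖g‖ := h2 ▸ real_inner_le_norm h g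
  nlinarith [sq_nonneg (8 * ‖h‖ - ‖g‖)]

theorem IsRegular.add_outer (hB : IsRegular B) (g : EuclideanSpace ℝ (Fin d)) :
    IsRegular (B + outer g) where
  symm := hB.symm.add (outer_isSymm g)
  le x := by
    rw [bilin_add_matrix, bilin_outer]
    nlinarith [hB.le x, mul_self_nonneg (inner ℝ x g)]

/-- The matrix determinant lemma; it lets `log (1 + invForm B g)` telescope as a difference of
log-determinants. -/
theorem IsRegular.det_add_outer (hB : IsRegular B) (g : EuclideanSpace ℝ (Fin d)) :
    (B + outer g).det = B.det * (1 + invForm B g) := by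
  have hu : IsUnit B.det := hB.posDef.det_pos.ne'.isUnit
  have ho : outer g = Matrix.replicateCol Unit g.ofLp * Matrix.replicateRow Unit g.ofLp :=
    Matrix.vecMulVec_eq Unit _ _
  rw [ho, Matrix.det_add_replicateCol_mul_replicateRow hu]
  congr 1
  rw [Matrix.det_unique, Matrix.add_apply, Matrix.one_apply_eq, Matrix.mul_assoc]
  congr 1

/-- The bound `log s ≥ 1 - 1/s` is used at `s = √(1 + x)`: at `1 + x` itself it would only cover `x
≤ 1`, while the potential increments can reach `9/8`. -/
theorem le_two_mul_log_one_add {x : ℝ} (h0 : 0 ≤ x) (h1 : x ≤ 9 / 8) :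
    x ≤ 2 * Real.log (1 + x) := by
  have h2 := Real.one_sub_inv_le_log_of_pos (x := Real.sqrt (1 + x)) (by positivity)
  rw [Real.log_sqrt (by positivity)] at h2
  set s := Real.sqrt (1 + x)
  have hs : s ^ 2 = 1 + x := Real.sq_sqrt (by positivity)
  have hs1 : 1 ≤ s := Real.one_le_sqrt.2 (by linarith)
  have hs2 : s ≤ 3 / 2 := by nlinarith
  have h3 : x ≤ 4 * (1 - s⁻¹) := by
    have : 4 * (1 - s⁻¹) - x = (s - 1) * (4 - s * (s + 1)) / s := by
      field_simp
      linear_combination s * hs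
    have h4 : 0 ≤ (s - 1) * (4 - s * (s + 1)) / s :=
      div_nonneg (mul_nonneg (by linarith) (by nlinarith)) (by linarith)
    linarith
  linarith

end Quadratic

section Elliptical

variable {d : ℕ}

/-- The characteristic polynomial of `G` evaluated at `-8`, up to the sign `(-1)^d` on both sides.
-/
theorem det_eight_add {G : Matrix (Fin d) (Fin d) ℝ} (hG : G.IsHermitian) :
    ((8 : ℝ) • (1 : Matrix (Fin d) (Fin d) ℝ) + G).det = ∏ i, (8 + hG.eigenvalues i) := by
  have h1 := Matrix.eval_charpoly G (-8)
  rw [hG.charpoly_eq, Polynomial.eval_prod] at h1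
  have h2 : Matrix.scalar (Fin d) (-8 : ℝ) - G
      = -((8 : ℝ) • (1 : Matrix (Fin d) (Fin d) ℝ) + G) := by
    rw [Matrix.scalar_apply, ← Matrix.smul_one_eq_diagonal, neg_smul]
    abel
  rw [h2, Matrix.det_neg] at h1
  have h3 : ∏ i, Polynomial.eval (-8) (Polynomial.X - Polynomial.C (hG.eigenvalues i))
      = (-1) ^ Fintype.card (Fin d) * ∏ i, (8 + hG.eigenvalues i) := by
    rw [← Finset.card_univ, ← Finset.prod_const, ← Finset.prod_mul_distrib]
    refine Finset.prod_congr rfl fun i _ => ?_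
    simp
    ring
  have h4 : ((-1 : ℝ) ^ Fintype.card (Fin d)) ≠ 0 := by simp
  exact mul_left_cancel₀ h4 (h1.symm.trans h3)

/-- Here the rank replaces the dimension: a zero eigenvalue contributes exactly the `log 8` already
present in `det (8I)`, and a nonzero one is at most the trace. -/
theorem log_det_eight_add_le {G : Matrix (Fin d) (Fin d) ℝ} (hG : G.PosSemidef) {τ : ℝ}
    (hτ : G.trace ≤ τ) :
    Real.log ((8 : ℝ) • (1 : Matrix (Fin d) (Fin d) ℝ) + G).det
      ≤ Real.log ((8 : ℝ) • (1 : Matrix (Fin d) (Fin d) ℝ)).det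
        + G.rank * Real.log (1 + τ / 8) := by
  have h0 := hG.eigenvalues_nonneg
  have hle : ∀ i, hG.1.eigenvalues i ≤ τ := fun i => by
    have h1 := hG.1.trace_eq_sum_eigenvalues
    simp only [RCLike.ofReal_real_eq_id, id] at h1
    have h2 : hG.1.eigenvalues i ≤ ∑ j, hG.1.eigenvalues j :=
      Finset.single_le_sum (fun j _ => h0 j) (Finset.mem_univ i)
    linarith
  rw [det_eight_add hG.1, Real.log_prod (fun i _ => by have := h0 i; positivity),
    Matrix.det_smul, Matrix.det_one, mul_one, Real.log_pow, hG.1.rank_eq_card_non_zero_eigs,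
    Fintype.card_subtype]
  have h1 : ∀ i, Real.log (8 + hG.1.eigenvalues i) ≤ Real.log 8
      + if hG.1.eigenvalues i ≠ 0 then Real.log (1 + τ / 8) else 0 := by
    intro i
    split_ifs with hi
    · have := h0 i
      rw [← Real.log_mul (by norm_num) (by have := this.trans (hle i); positivity)]
      exact Real.log_le_log (by positivity) (by have := hle i; linarith)
    · simp [not_not.1 hi]
  refine (Finset.sum_le_sum fun i _ => h1 i).trans (le_of_eq ?_)
  rw [Finset.sum_add_distrib, ← Finset.sum_filter]
  simp

/-- The partial sums `∑_{s < t} gₛ gₛᵀ`. -/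
def gramSum (g : ℕ → EuclideanSpace ℝ (Fin d)) (t : ℕ) : Matrix (Fin d) (Fin d) ℝ :=
  ∑ s ∈ Finset.range t, outer (g s)

theorem gramSum_succ (g : ℕ → EuclideanSpace ℝ (Fin d)) (t : ℕ) :
    gramSum g (t + 1) = gramSum g t + outer (g t) :=
  Finset.sum_range_succ _ _

theorem isRegular_gramSum (g : ℕ → EuclideanSpace ℝ (Fin d)) (t : ℕ) :
    IsRegular ((8 : ℝ) • (1 : Matrix (Fin d) (Fin d) ℝ) + gramSum g t) := by
  induction t with
  | zero =>
    refine ⟨?_, fun x => ?_⟩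
    · simp [gramSum, Matrix.IsSymm]
    · simp [gramSum, bilin_smul_matrix, bilin_one]
  | succ t ih =>
    rw [gramSum_succ, ← add_assoc]
    exact ih.add_outer _

/-- The matrix with columns `g 0, …, g (T - 1)`. -/
def columns (T : ℕ) (g : ℕ → EuclideanSpace ℝ (Fin d)) : Matrix (Fin d) (Fin T) ℝ :=
  Matrix.of fun i t => g t i

theorem gramSum_eq_mul_transpose (g : ℕ → EuclideanSpace ℝ (Fin d)) (T : ℕ) :
    gramSum g T = columns T g * (columns T g).transpose := by
  ext i j
  rw [gramSum, Matrix.sum_apply, Matrix.mul_apply,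
    ← Fin.sum_univ_eq_sum_range (fun t => outer (g t) i j)]
  rfl

theorem gramSum_posSemidef (g : ℕ → EuclideanSpace ℝ (Fin d)) (T : ℕ) :
    (gramSum g T).PosSemidef := by
  rw [gramSum_eq_mul_transpose, ← Matrix.conjTranspose_eq_transpose_of_trivial]
  exact Matrix.posSemidef_self_mul_conjTranspose _

/-- A Gram sum has the rank of its column matrix, and rescaling columns is right multiplication by a
diagonal matrix. -/
theorem rank_gramSum_le {T : ℕ} {g v : ℕ → EuclideanSpace ℝ (Fin d)} {c : ℕ → ℝ}
    (h : ∀ t < T, g t = c t • v t) : (gramSum g T).rank ≤ (gramSum v T).rank := by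
  have hc : columns T g = columns T v * Matrix.diagonal fun t : Fin T => c t := by
    ext i t
    simp [columns, h t t.2, mul_comm]
  rw [gramSum_eq_mul_transpose, gramSum_eq_mul_transpose, Matrix.rank_self_mul_transpose,
    Matrix.rank_self_mul_transpose, hc]
  exact Matrix.rank_mul_le_left _ _

theorem trace_outer (v : EuclideanSpace ℝ (Fin d)) : (outer v).trace = ‖v‖ ^ 2 := by
  rw [EuclideanSpace.real_norm_sq_eq]
  simp [outer, Matrix.trace, Matrix.vecMulVec_apply, sq]

/-- The elliptical potential lemma. -/
theorem sum_invForm_le {T : ℕ} {g : ℕ → EuclideanSpace ℝ (Fin d)} (hg : ∀ t < T, ‖g t‖ ≤ 3) :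
    ∑ t ∈ Finset.range T,
        invForm ((8 : ℝ) • (1 : Matrix (Fin d) (Fin d) ℝ) + gramSum g t) (g t)
      ≤ 2 * ((gramSum g T).rank * Real.log (1 + 9 * T / 8)) := by
  set B : ℕ → Matrix (Fin d) (Fin d) ℝ :=
    fun t => (8 : ℝ) • (1 : Matrix (Fin d) (Fin d) ℝ) + gramSum g t with hB
  have hreg : ∀ t, IsRegular (B t) := isRegular_gramSum g
  have hsq : ∀ t < T, ‖g t‖ ^ 2 ≤ 9 := fun t ht => by
    nlinarith [hg t ht, norm_nonneg (g t)]
  have h1 : ∀ t ∈ Finset.range T, invForm (B t) (g t)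
      ≤ 2 * (Real.log (B (t + 1)).det - Real.log (B t).det) := by
    intro t ht
    have hx := (hreg t).invForm_nonneg (g t)
    have hx' := (hreg t).invForm_le (g t)
    have hd : (B (t + 1)).det = (B t).det * (1 + invForm (B t) (g t)) := by
      rw [← (hreg t).det_add_outer, hB]
      simp only [gramSum_succ, add_assoc]
    rw [hd, Real.log_mul (hreg t).posDef.det_pos.ne' (by positivity), add_sub_cancel_left]
    exact le_two_mul_log_one_add hx (by linarith [hsq t (Finset.mem_range.1 ht)])
  refine (Finset.sum_le_sum h1).trans ?_
  rw [← Finset.mul_sum, Finset.sum_range_sub (fun t => Real.log (B t).det)]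
  have htr : (gramSum g T).trace ≤ 9 * T := by
    rw [gramSum, Matrix.trace_sum]
    calc _ ≤ ∑ t ∈ Finset.range T, (9 : ℝ) := Finset.sum_le_sum fun t ht => by
          rw [trace_outer]; exact hsq t (Finset.mem_range.1 ht)
      _ = 9 * T := by simp [mul_comm]
  have h2 := log_det_eight_add_le (gramSum_posSemidef g T) htr
  have h3 : B 0 = (8 : ℝ) • (1 : Matrix (Fin d) (Fin d) ℝ) := by simp [hB, gramSum]
  rw [h3]
  linarith

end Elliptical

/-! ### Regret of the base algorithm -/

section Base

variable {d : ℕ}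

/-- It follows that `∇ₜ - mₜ` is a scalar multiple of `ℓₜ - mₜ`, so the algorithm's own matrix has
rank at most `errorRank`. -/
theorem MetaGradState.grad_eq (K : Set (EuclideanSpace ℝ (Fin d))) (η : ℝ) (s : MetaGradState d)
    (m ℓ wbar : EuclideanSpace ℝ (Fin d)) :
    s.grad K η m ℓ wbar
      = ℓ + (32 * η * inner ℝ (s.decide K η m - wbar) (ℓ - m)) • (ℓ - m) := by
  set w := s.decide K η m
  refine HasGradientAt.gradient ?_
  rw [hasGradientAt_iff_hasFDerivAt]
  have h1 : HasFDerivAt (fun w : EuclideanSpace ℝ (Fin d) => (inner ℝ w ℓ : ℝ)) (innerSL ℝ ℓ) w := by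
    have := (innerSL ℝ ℓ).hasFDerivAt (x := w)
    simpa [real_inner_comm] using this
  have h2 : HasFDerivAt (fun w : EuclideanSpace ℝ (Fin d) => (inner ℝ (w - wbar) (ℓ - m) : ℝ))
      (innerSL ℝ (ℓ - m)) w := by
    have h := ((innerSL ℝ (ℓ - m)).hasFDerivAt (x := w - wbar)).comp w
      ((hasFDerivAt_id w).sub_const wbar)
    have he : (fun w : EuclideanSpace ℝ (Fin d) => (inner ℝ (w - wbar) (ℓ - m) : ℝ))
        = innerSL ℝ (ℓ - m) ∘ fun w => id w - wbar :=
      funext fun w => real_inner_comm _ _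
    rw [he]
    exact h
  refine (h1.add ((h2.pow 2).const_mul (16 * η))).congr_fderiv ?_
  ext1 y
  simp
  ring

/-- A run of the base algorithm. -/
structure IsRun (K : Set (EuclideanSpace ℝ (Fin d))) (η : ℝ)
    (m ℓ wbar : ℕ → EuclideanSpace ℝ (Fin d)) (s : ℕ → MetaGradState d) : Prop where
  zero : s 0 = ⟨0, 0⟩
  succ : ∀ t, s (t + 1) = (s t).update K η (m t) (ℓ t) (wbar t)

/-- One step of optimistic mirror descent with quadratic regularizer `η B`. -/
theorem optimistic_step {B : Matrix (Fin d) (Fin d) ℝ} (hB : IsRegular B) {η : ℝ} (hη : 0 < η)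
    {c w z u m g v : EuclideanSpace ℝ (Fin d)} {κ : ℝ}
    (hg : g = κ • v) (hκ : κ ^ 2 ≤ 9) (hv : ‖v‖ ≤ 1)
    (hw : 0 ≤ inner ℝ (z - w) m + bilin (η • B) (z - w) (w - c))
    (hz : 0 ≤ inner ℝ (w - z) (m + g) + bilin (η • B) (w - z) (z - c))
    (hu : 0 ≤ inner ℝ (u - z) (m + g) + bilin (η • B) (u - z) (z - c)) :
    inner ℝ (w - u) (m + g) ≤ 1 / 2 * bilin (η • B) (u - c) (u - c)
      - 1 / 2 * bilin (η • (B + outer g)) (u - z) (u - z)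
      + 9 * η * inner ℝ (w - u) v ^ 2 + 17 / 8 * (η⁻¹ * invForm B g) := by
  have hx0 := hB.invForm_nonneg g
  have hx1 := hB.invForm_le g
  have hg2 : ‖g‖ ^ 2 ≤ 9 := by
    rw [hg, norm_smul, mul_pow, Real.norm_eq_abs, sq_abs]
    nlinarith [norm_nonneg v, sq_nonneg κ]
  have hcs := hB.inner_sq_le (w - z) g
  have hwu : inner ℝ (w - u) g ^ 2 ≤ 9 * inner ℝ (w - u) v ^ 2 := by
    rw [hg, real_inner_smul_right, mul_pow]
    exact mul_le_mul_of_nonneg_right hκ (sq_nonneg _)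
  have hn : 0 ≤ bilin B (w - z) (w - z) := le_trans (by positivity) (hB.le _)
  set X := η⁻¹ * invForm B g with hX
  have hηX : η * X = invForm B g := by rw [hX]; field_simp
  have hX0 : 0 ≤ X := by positivity
  set q := inner ℝ (w - z) g with hq
  set n := bilin B (w - z) (w - z) with hnn
  -- stability of the two prox steps
  have hstab : η * n ≤ q := by
    rw [hq, hnn]
    have h1 := hw
    have h2 := hz
    simp only [bilin_smul_matrix, bilin_sub_left, bilin_sub_right, inner_sub_left,
      inner_add_right] at h1 h2 ⊢
    linarith
  have hq0 : 0 ≤ q := le_trans (by positivity) hstab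
  have hqX : q ≤ X := by
    by_contra! h
    have : q ^ 2 ≤ q * X := by
      calc q ^ 2 ≤ n * invForm B g := hcs
        _ = (η * n) * X := by rw [← hηX]; ring
        _ ≤ q * X := mul_le_mul_of_nonneg_right hstab hX0
    nlinarith
  -- Passing from `B` to `B + outer g` in the potential costs `η/2 · ⟨u - z, g⟩²`. Moving it from
  -- `z` to `w` leaves `η⟨w - u, g⟩²`, the source of the `9η` term, and `ηq² ≤ 9/8 X`; with `q ≤ X`
  -- this gives `17/8`.
  have hquad : inner ℝ (u - z) g ^ 2 ≤ 2 * inner ℝ (w - u) g ^ 2 + 2 * q ^ 2 := by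
    have : inner ℝ (u - z) g = q - inner ℝ (w - u) g := by
      rw [hq, ← inner_sub_left]; congr 1; abel
    rw [this]
    nlinarith [sq_nonneg (q + inner ℝ (w - u) g)]
  have hηq : η * q ^ 2 ≤ 9 / 8 * X := by
    have h1 : q ^ 2 ≤ X * X := by nlinarith
    have h2 : η * q ^ 2 ≤ η * (X * X) := mul_le_mul_of_nonneg_left h1 hη.le
    have h3 : η * X ≤ 9 / 8 := by rw [hηX]; linarith
    nlinarith
  have hmain : inner ℝ (w - u) (m + g) ≤ 1 / 2 * bilin (η • B) (u - c) (u - c)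
      - 1 / 2 * bilin (η • B) (u - z) (u - z) + q := by
    have hn' : 0 ≤ η * n := by positivity
    have hcw : 0 ≤ η * bilin B (w - c) (w - c) :=
      mul_nonneg hη.le (le_trans (by positivity) (hB.le _))
    rw [hq]
    rw [hnn] at hn'
    simp only [bilin_smul_matrix, bilin_sub_left, bilin_sub_right, inner_sub_left,
      inner_add_right, bilin_comm c w hB.symm, bilin_comm z w hB.symm,
      bilin_comm u z hB.symm, bilin_comm u c hB.symm] at hw hu hn' hcw ⊢
    linarith
  have hpot : bilin (η • (B + outer g)) (u - z) (u - z)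
      = bilin (η • B) (u - z) (u - z) + η * inner ℝ (u - z) g ^ 2 := by
    rw [bilin_smul_matrix, bilin_add_matrix, bilin_outer, bilin_smul_matrix]; ring
  rw [hpot]
  have h1 := mul_le_mul_of_nonneg_left hquad hη.le
  have h2 := mul_le_mul_of_nonneg_left hwu hη.le
  linarith

/-- The regret of the base algorithm on the surrogate losses. -/
theorem IsRun.regret_le {K : Set (EuclideanSpace ℝ (Fin d))} (hK : IsCompact K) (hc : Convex ℝ K)
    {D : ℝ} (hKD : ∀ w ∈ K, ‖w‖ ≤ D) {η : ℝ} (hη : 0 < η) (hηD : 32 * η * D ≤ 1) {T : ℕ}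
    {m ℓ wbar : ℕ → EuclideanSpace ℝ (Fin d)} {s : ℕ → MetaGradState d}
    (hs : IsRun K η m ℓ wbar s) (hℓ : ∀ t < T, ‖ℓ t - m t‖ ≤ 1) (hwbar : ∀ t < T, wbar t ∈ K)
    {u : EuclideanSpace ℝ (Fin d)} (hu : u ∈ K) :
    ∑ t ∈ Finset.range T, (inner ℝ ((s t).decide K η (m t) - u) (ℓ t)
        + 16 * η * inner ℝ ((s t).decide K η (m t) - wbar t) (ℓ t - m t) ^ 2
        - 16 * η * inner ℝ (u - wbar t) (ℓ t - m t) ^ 2)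
      ≤ 4 * η * D ^ 2
        + 17 / 4 * (η⁻¹ * ((errorRank T m ℓ : ℝ) * Real.log (1 + 9 * T / 8))) := by
  set w : ℕ → EuclideanSpace ℝ (Fin d) := fun t => (s t).decide K η (m t) with hw
  set v : ℕ → EuclideanSpace ℝ (Fin d) := fun t => ℓ t - m t with hv
  set κ : ℕ → ℝ := fun t => 1 + 32 * η * inner ℝ (w t - wbar t) (v t) with hκ
  set g : ℕ → EuclideanSpace ℝ (Fin d) := fun t => κ t • v t with hg
  have hgrad : ∀ t, (s t).grad K η (m t) (ℓ t) (wbar t) = m t + g t := by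
    intro t
    rw [MetaGradState.grad_eq]
    simp only [hg, hκ, hv, add_smul, one_smul]
    rw [← add_assoc, add_sub_cancel]
  have hgram : ∀ t, (s t).gram = gramSum g t := by
    intro t
    induction t with
    | zero => simp [hs.zero, gramSum]
    | succ t ih =>
      rw [hs.succ, gramSum_succ, MetaGradState.update, hgrad, ih, add_sub_cancel_left]
  set B : ℕ → Matrix (Fin d) (Fin d) ℝ :=
    fun t => (8 : ℝ) • (1 : Matrix (Fin d) (Fin d) ℝ) + gramSum g t with hB
  have hreg : ∀ t, IsRegular (B t) := isRegular_gramSum g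
  have hsymm : ∀ t, (η • B t).IsSymm := fun t => (hreg t).symm.smul η
  have hsreg : ∀ t, (s t).reg η = quadReg (η • B t) := fun t => by
    rw [MetaGradState.reg, hgram]
  have hpw : ∀ t, w t ∈ K ∧ ∀ x ∈ K, 0 ≤ inner ℝ (x - w t) (m t)
      + bilin (η • B t) (x - w t) (w t - (s t).center) := by
    intro t
    have := prox_quadReg hK hc ⟨u, hu⟩ (hsymm t) (m t) (s t).center
    rw [← hsreg] at this
    exact this
  have hpz : ∀ t, (s (t + 1)).center ∈ K ∧ ∀ x ∈ K, 0 ≤ inner ℝ (x - (s (t + 1)).center) (m t + g t)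
      + bilin (η • B t) (x - (s (t + 1)).center) ((s (t + 1)).center - (s t).center) := by
    intro t
    have := prox_quadReg hK hc ⟨u, hu⟩ (hsymm t) (m t + g t) (s t).center
    rw [← hsreg, ← hgrad] at this
    rw [← hgrad, hs.succ]
    exact this
  -- Since `32ηD ≤ 1`, the scalar `κ t` deviates from `1` by at most `2`.
  have hκ9 : ∀ t < T, κ t ^ 2 ≤ 9 := by
    intro t ht
    have h1 : |inner ℝ (w t - wbar t) (v t)| ≤ 2 * D := by
      have ha := abs_real_inner_le_norm (w t - wbar t) (v t)
      have hb := norm_sub_le (w t) (wbar t)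
      have hc := hKD _ (hpw t).1
      have hd := hKD _ (hwbar t ht)
      have he := hℓ t ht
      have hf := norm_nonneg (w t - wbar t)
      have hg := mul_le_mul_of_nonneg_left he hf
      linarith
    obtain ⟨h2, h3⟩ := abs_le.1 h1
    have h4 : 32 * η * inner ℝ (w t - wbar t) (v t) ≤ 32 * η * (2 * D) :=
      mul_le_mul_of_nonneg_left h3 (by positivity)
    have h5 : 32 * η * (-(2 * D)) ≤ 32 * η * inner ℝ (w t - wbar t) (v t) :=
      mul_le_mul_of_nonneg_left h2 (by positivity)
    simp only [hκ]
    nlinarith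
  have hg3 : ∀ t < T, ‖g t‖ ≤ 3 := by
    intro t ht
    have h1 : |κ t| ≤ 3 := abs_le_of_sq_le_sq (by linarith [hκ9 t ht]) (by norm_num)
    simp only [hg, norm_smul, Real.norm_eq_abs]
    nlinarith [hℓ t ht, norm_nonneg (v t), abs_nonneg (κ t)]
  set Φ : ℕ → ℝ := fun t => 1 / 2 * bilin (η • B t) (u - (s t).center) (u - (s t).center) with hΦ
  have hstep : ∀ t ∈ Finset.range T, inner ℝ (w t - u) (ℓ t)
        + 16 * η * inner ℝ (w t - wbar t) (ℓ t - m t) ^ 2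
        - 16 * η * inner ℝ (u - wbar t) (ℓ t - m t) ^ 2
      ≤ (Φ t - Φ (t + 1)) + 17 / 8 * (η⁻¹ * invForm (B t) (g t)) := by
    intro t ht
    rw [Finset.mem_range] at ht
    have h := optimistic_step (hreg t) hη (g := g t) rfl (hκ9 t ht) (hℓ t ht)
      ((hpw t).2 _ (hpz t).1) ((hpz t).2 _ (hpw t).1) ((hpz t).2 u hu)
    have hB1 : B t + outer (g t) = B (t + 1) := by
      simp only [hB, gramSum_succ, add_assoc]
    rw [hB1] at h
    have h1 : inner ℝ (w t - u) (m t + g t) = inner ℝ (w t - u) (ℓ t)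
        + 32 * η * inner ℝ (w t - wbar t) (v t) * inner ℝ (w t - u) (v t) := by
      have : m t + g t = ℓ t + (32 * η * inner ℝ (w t - wbar t) (v t)) • v t := by
        simp only [hg, hκ, hv, add_smul, one_smul]
        rw [← add_assoc, add_sub_cancel]
      rw [this, inner_add_right, real_inner_smul_right]
    have h2 : inner ℝ (u - wbar t) (v t)
        = inner ℝ (w t - wbar t) (v t) - inner ℝ (w t - u) (v t) := by
      rw [← inner_sub_left]; congr 1; abel
    change _ + 16 * η * inner ℝ (w t - wbar t) (v t) ^ 2
      - 16 * η * inner ℝ (u - wbar t) (v t) ^ 2 ≤ _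
    rw [h1] at h
    rw [h2]
    simp only [hΦ]
    -- The surrogate is quadratic, so its linearization is off by exactly `16η⟨w - u, v⟩²`, which
    -- pays for the `9η⟨w - u, v⟩²` of the mirror step.
    nlinarith [mul_nonneg hη.le (sq_nonneg (inner ℝ (w t - u) (v t)))]
  refine (Finset.sum_le_sum hstep).trans ?_
  rw [Finset.sum_add_distrib, Finset.sum_range_sub', ← Finset.mul_sum, ← Finset.mul_sum]
  -- The initial centre `0` need not lie in `K`; only `‖u‖ ≤ D` matters.
  have hΦ0 : Φ 0 ≤ 4 * η * D ^ 2 := by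
    have : Φ 0 = 4 * η * ‖u‖ ^ 2 := by
      simp only [hΦ, hs.zero, hB, gramSum, Finset.range_zero, Finset.sum_empty, add_zero,
        sub_zero, bilin_smul_matrix, bilin_one, real_inner_self_eq_norm_sq]
      ring
    rw [this]
    have := hKD u hu
    gcongr
  have hΦT : 0 ≤ Φ T := by
    simp only [hΦ, bilin_smul_matrix]
    have : 0 ≤ bilin (B T) (u - (s T).center) (u - (s T).center) :=
      le_trans (by positivity) ((hreg T).le _)
    positivity
  have hell := sum_invForm_le hg3
  have hrank : ((gramSum g T).rank : ℝ) ≤ errorRank T m ℓ :=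
    Nat.cast_le.2 (rank_gramSum_le fun t _ => rfl)
  have hlog : 0 ≤ Real.log (1 + 9 * T / 8) :=
    Real.log_nonneg (by have : (0 : ℝ) ≤ T := T.cast_nonneg; linarith)
  have hfin : η⁻¹ * ∑ t ∈ Finset.range T, invForm (B t) (g t)
      ≤ η⁻¹ * (2 * ((errorRank T m ℓ : ℝ) * Real.log (1 + 9 * T / 8))) := by
    refine mul_le_mul_of_nonneg_left (hell.trans ?_) (by positivity)
    gcongr
  linarith

end Base

/-! ### Entropic mirror steps -/

section Entropy

variable {N : ℕ} {η : Fin N → ℝ} {p : Fin N → ℝ}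

/-- Only the base point must be positive, for differentiability; `q` may lie on the boundary of the
simplex, where `0 * log 0 = 0`. -/
theorem bregman_weightedEntropy (hp : ∀ k, 0 < p k) (q : Fin N → ℝ) :
    bregman (weightedEntropy η) q p
      = ∑ k, (η k)⁻¹ * (q k * Real.log (q k) - q k * Real.log (p k) - q k + p k) := by
  have h : ∀ k ∈ Finset.univ, HasFDerivAt (fun p : Fin N → ℝ => p k / η k * Real.log (p k))
      (((Real.log (p k) + 1) * (η k)⁻¹) • (ContinuousLinearMap.proj k : (Fin N → ℝ) →L[ℝ] ℝ)) p := by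
    intro k _
    have h1 := (Real.hasDerivAt_mul_log (hp k).ne').mul_const (η k)⁻¹
    have h2 := h1.comp_hasFDerivAt p
      (ContinuousLinearMap.proj (R := ℝ) (φ := fun _ : Fin N => ℝ) k).hasFDerivAt
    refine h2.congr_of_eventuallyEq (Filter.Eventually.of_forall fun q => ?_)
    simp [div_eq_mul_inv]
    ring
  have hs : HasFDerivAt (weightedEntropy η) _ p := HasFDerivAt.fun_sum h
  rw [bregman, hs.fderiv, weightedEntropy, weightedEntropy, ← Finset.sum_sub_distrib]
  simp only [_root_.sum_apply, _root_.smul_apply,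
    ContinuousLinearMap.proj_apply, smul_eq_mul, Pi.sub_apply]
  rw [← Finset.sum_sub_distrib]
  refine Finset.sum_congr rfl fun k _ => ?_
  ring

theorem entropy_term_eq {a b : ℝ} (ha : 0 < a) (hb : 0 ≤ b) :
    b * Real.log b - b * Real.log a - b + a = a * InformationTheory.klFun (b / a) := by
  rw [InformationTheory.klFun]
  rcases hb.eq_or_lt with rfl | hb
  · simp
  · rw [Real.log_div hb.ne' ha.ne']
    field_simp
    ring

/-- The normalizing constant of an entropic mirror step. -/
theorem exists_normalizer (hN : 0 < N) (hη : ∀ k, 0 < η k) (hp : ∀ k, 0 < p k) (x : Fin N → ℝ) :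
    ∃ c : ℝ, ∑ k, p k * Real.exp (-η k * (x k - c)) = 1 := by
  have hcont : Continuous fun c : ℝ => ∑ k, p k * Real.exp (-η k * (x k - c)) := by fun_prop
  refine mem_range_of_exists_le_of_exists_ge hcont ?_ ?_
  · have hlim : Filter.Tendsto (fun c : ℝ => ∑ k, p k * Real.exp (-η k * (x k - c))) Filter.atBot
        (nhds (∑ k : Fin N, p k * 0)) := by
      refine tendsto_finsetSum _ fun k _ => Filter.Tendsto.const_mul _ ?_
      refine Real.tendsto_exp_atBot.comp ?_
      have : (fun c : ℝ => -η k * (x k - c)) = fun c => η k * c + -η k * x k := by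
        funext c; ring
      rw [this]
      exact Filter.tendsto_atBot_add_const_right _ _
        (Filter.tendsto_id.const_mul_atBot (hη k))
    simp only [mul_zero, Finset.sum_const_zero] at hlim
    exact (hlim.eventually (eventually_le_nhds one_pos)).exists
  · let k : Fin N := ⟨0, hN⟩
    refine ⟨x k - Real.log (p k) / η k, ?_⟩
    have h1 : p k * Real.exp (-η k * (x k - (x k - Real.log (p k) / η k))) = 1 := by
      have : -η k * (x k - (x k - Real.log (p k) / η k)) = -Real.log (p k) := by
        have := (hη k).ne'
        field_simp
        ring
      rw [this, Real.exp_neg, Real.exp_log (hp k), mul_inv_cancel₀ (hp k).ne']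
    rw [← h1]
    exact Finset.single_le_sum (f := fun j => p j * Real.exp (-η j *
      (x j - (x k - Real.log (p k) / η k)))) (fun j _ => by have := hp j; positivity)
      (Finset.mem_univ k)

/-- The minimizer of an entropic mirror step over the simplex. -/
theorem argminOn_entropy (hN : 0 < N) (hη : ∀ k, 0 < η k) (hp : ∀ k, 0 < p k) (x : Fin N → ℝ) :
    let q := argminOn (fun q => ∑ k, q k * x k + bregman (weightedEntropy η) q p)
      (stdSimplex ℝ (Fin N))
    ∃ c : ℝ, (∀ k, q k = p k * Real.exp (-η k * (x k - c))) ∧ q ∈ stdSimplex ℝ (Fin N) := by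
  intro q
  obtain ⟨c, hc⟩ := exists_normalizer hN hη hp x
  set e : Fin N → ℝ := fun k => p k * Real.exp (-η k * (x k - c)) with he
  have he0 : ∀ k, 0 < e k := fun k => mul_pos (hp k) (Real.exp_pos _)
  have hemem : e ∈ stdSimplex ℝ (Fin N) := ⟨fun k => (he0 k).le, hc⟩
  -- On the simplex the objective is a constant plus a weighted Kullback–Leibler divergence from
  -- `e`. It vanishes only at `e`, so the minimizer is unique.
  have key : ∀ q ∈ stdSimplex ℝ (Fin N),
      ∑ k, q k * x k + bregman (weightedEntropy η) q p
        = (c + ∑ k, (η k)⁻¹ * (p k - e k))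
          + ∑ k, (η k)⁻¹ * (e k * InformationTheory.klFun (q k / e k)) := by
    intro q hq
    have h1 : c = ∑ k, q k * c := by rw [← Finset.sum_mul, hq.2, one_mul]
    rw [bregman_weightedEntropy hp]
    suffices h : _ = (∑ k, q k * c + ∑ k, (η k)⁻¹ * (p k - e k))
        + ∑ k, (η k)⁻¹ * (e k * InformationTheory.klFun (q k / e k)) from h.trans (by rw [← h1])
    rw [← Finset.sum_add_distrib, ← Finset.sum_add_distrib, ← Finset.sum_add_distrib]
    refine Finset.sum_congr rfl fun k _ => ?_
    rw [← entropy_term_eq (he0 k) (hq.1 k)]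
    have h2 : Real.log (e k) = Real.log (p k) + -η k * (x k - c) := by
      rw [he, Real.log_mul (hp k).ne' (Real.exp_pos _).ne', Real.log_exp]
    rw [h2]
    have := (hη k).ne'
    field_simp
    ring
  have hkl : ∀ q ∈ stdSimplex ℝ (Fin N), ∀ k,
      0 ≤ (η k)⁻¹ * (e k * InformationTheory.klFun (q k / e k)) := fun q hq k =>
    mul_nonneg (inv_nonneg.2 (hη k).le) (mul_nonneg (he0 k).le
      (InformationTheory.klFun_nonneg (div_nonneg (hq.1 k) (he0 k).le)))
  have hself : ∑ k, (η k)⁻¹ * (e k * InformationTheory.klFun (e k / e k)) = 0 :=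
    Finset.sum_eq_zero fun k _ => by
      rw [div_self (he0 k).ne', InformationTheory.klFun_one, mul_zero, mul_zero]
  obtain ⟨hq, hmin⟩ := argminOn_spec (S := stdSimplex ℝ (Fin N))
    (f := fun q => ∑ k, q k * x k + bregman (weightedEntropy η) q p)
    ⟨e, hemem, isMinOn_iff.2 fun q hq => by
      rw [key e hemem, key q hq, hself]
      have := Finset.sum_nonneg fun k (_ : k ∈ Finset.univ) => hkl q hq k
      linarith⟩
  refine ⟨c, fun k => ?_, hq⟩
  have h := isMinOn_iff.1 hmin e hemem
  rw [key e hemem, key _ hq, hself] at h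
  have h0 := (Finset.sum_eq_zero_iff_of_nonneg fun k (_ : k ∈ Finset.univ) => hkl _ hq k).1
    (le_antisymm (by linarith) (Finset.sum_nonneg fun k _ => hkl _ hq k)) k (Finset.mem_univ k)
  have h1 : InformationTheory.klFun (q k / e k) = 0 := by
    have h2 := (inv_pos.2 (hη k)).ne'
    have h3 := (he0 k).ne'
    simpa [h2, h3, (hη k).ne'] using h0
  rw [InformationTheory.klFun_eq_zero_iff (div_nonneg (hq.1 k) (he0 k).le),
    div_eq_one_iff_eq (he0 k).ne'] at h1
  exact h1

/-- One round of optimistic mirror descent with the weighted entropy. -/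
theorem entropy_step (hη : ∀ k, 0 < η k) (hp : ∀ k, 0 < p k) {q p' h g b : Fin N → ℝ}
    {c c' : ℝ} (hq : ∀ k, q k = p k * Real.exp (-η k * (h k - c))) (hqs : ∑ k, q k = 1)
    (hp' : ∀ k, p' k = p k * Real.exp (-η k * (g k + b k - c'))) (hps : ∑ k, p' k = 1)
    (hsmall : ∀ k, η k * |g k + b k - h k| ≤ 1)
    (hb : ∀ k, η k * (g k + b k - h k) ^ 2 ≤ b k) (k : Fin N) :
    ∑ j, q j * g j - g k - b k
      ≤ (-(η k)⁻¹ * Real.log (p k) + ∑ j, (η j)⁻¹ * p j)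
        - (-(η k)⁻¹ * Real.log (p' k) + ∑ j, (η j)⁻¹ * p' j) := by
  have hq0 : ∀ k, 0 < q k := fun k => by rw [hq]; exact mul_pos (hp k) (Real.exp_pos _)
  -- Coordinatewise, `exp x ≥ 1 + x` handles both multipliers and `exp x ≤ 1 + x + x²` the
  -- prediction error, whose square is absorbed by `b`. Summed over `j`, the right side becomes
  -- `c'`, which cancels against `log (p' k)`.
  have hterm : ∀ j, (η j)⁻¹ * p' j + q j * g j - p j * (η j)⁻¹ ≤ c * q j - (c - c') * p' j := by
    intro j
    have hηj := (hη j).ne'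
    set y := g j + b j - h j with hy
    have h1 : p j = q j * Real.exp (η j * (h j - c)) := by
      rw [hq, mul_assoc, ← Real.exp_add]; simp
    have h2 : p' j = q j * Real.exp (-η j * (y + (c - c'))) := by
      rw [hp', hq, mul_assoc, ← Real.exp_add]
      congr 2
      rw [hy]
      ring
    have h3 : q j * (1 + η j * (h j - c)) ≤ p j := by
      rw [h1]
      exact mul_le_mul_of_nonneg_left (by linarith [Real.add_one_le_exp (η j * (h j - c))])
        (hq0 j).le
    have h4 : p' j * (1 + η j * (c - c')) ≤ q j * Real.exp (-η j * y) := by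
      have : q j * Real.exp (-η j * y) = p' j * Real.exp (η j * (c - c')) := by
        rw [h2, mul_assoc, ← Real.exp_add]
        congr 2
        ring
      rw [this]
      refine mul_le_mul_of_nonneg_left (by linarith [Real.add_one_le_exp (η j * (c - c'))]) ?_
      rw [h2]
      exact mul_nonneg (hq0 j).le (Real.exp_pos _).le
    have h5 : Real.exp (-η j * y) ≤ 1 - η j * y + η j * (η j * y ^ 2) := by
      have ha : |-η j * y| ≤ 1 := by
        rw [neg_mul, abs_neg, abs_mul, abs_of_pos (hη j)]
        exact hsmall j
      have := (abs_le.1 (Real.abs_exp_sub_one_sub_id_le ha)).2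
      nlinarith
    have h6 : 1 - η j * y + η j * (η j * y ^ 2) ≤ 1 - η j * (g j - h j) := by
      have := mul_le_mul_of_nonneg_left (hb j) (hη j).le
      have h7 : η j * y = η j * (g j - h j) + η j * b j := by rw [hy]; ring
      linarith
    have h7 := mul_le_mul_of_nonneg_left (h5.trans h6) (hq0 j).le
    have h8 : p' j + η j * (q j * g j) - p j ≤ η j * (c * q j - (c - c') * p' j) := by
      linarith
    refine le_of_mul_le_mul_left (le_of_eq_of_le ?_ h8) (hη j)
    field_simp
  have hsum := Finset.sum_le_sum fun j (_ : j ∈ Finset.univ) => hterm j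
  rw [Finset.sum_sub_distrib, Finset.sum_add_distrib, Finset.sum_sub_distrib, ← Finset.mul_sum,
    ← Finset.mul_sum, hqs, hps] at hsum
  have hlog : (η k)⁻¹ * Real.log (p' k) = (η k)⁻¹ * Real.log (p k) - (g k + b k - c') := by
    rw [hp', Real.log_mul (hp k).ne' (Real.exp_pos _).ne', Real.log_exp]
    have := (hη k).ne'
    field_simp
    ring
  have hcomm : ∑ j, p j * (η j)⁻¹ = ∑ j, (η j)⁻¹ * p j :=
    Finset.sum_congr rfl fun j _ => mul_comm _ _
  rw [neg_mul, neg_mul, hlog]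
  linarith

end Entropy

/-! ### Regret of the master against an expert -/

section MasterRegret

variable {V : Type} [NormedAddCommGroup V] [InnerProductSpace ℝ V] {N : ℕ}
  {𝓔 : Fin N → Expert V}

theorem MasterState.weights_mem (hN : 0 < N) (hη : ∀ k, 0 < (𝓔 k).rate) (s : MasterState 𝓔)
    (hp : ∀ k, 0 < s.prior k) (m : V) :
    s.weights (stdSimplex ℝ (Fin N)) m ∈ stdSimplex ℝ (Fin N) :=
  (argminOn_entropy hN hη hp (s.hint m)).choose_spec.2

theorem MasterState.update_prior_pos (hN : 0 < N) (hη : ∀ k, 0 < (𝓔 k).rate) (s : MasterState 𝓔)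
    (hp : ∀ k, 0 < s.prior k) (m ℓ : V) (k : Fin N) :
    0 < (s.update (stdSimplex ℝ (Fin N)) m ℓ).prior k := by
  obtain ⟨c, hc, -⟩ := argminOn_entropy hN hη hp
    fun k => s.baseLoss m ℓ k + s.correction (stdSimplex ℝ (Fin N)) m ℓ k
  exact lt_of_lt_of_eq (mul_pos (hp k) (Real.exp_pos _)) (hc k).symm

theorem MasterState.update_prior_mem (hN : 0 < N) (hη : ∀ k, 0 < (𝓔 k).rate) (s : MasterState 𝓔)
    (hp : ∀ k, 0 < s.prior k) (m ℓ : V) :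
    (s.update (stdSimplex ℝ (Fin N)) m ℓ).prior ∈ stdSimplex ℝ (Fin N) :=
  (argminOn_entropy hN hη hp fun k =>
    s.baseLoss m ℓ k + s.correction (stdSimplex ℝ (Fin N)) m ℓ k).choose_spec.2

/-- The Bregman divergence of the `k`-th vertex of the simplex from the prior, up to a constant. -/
def MasterState.potential (s : MasterState 𝓔) (k : Fin N) : ℝ :=
  -((𝓔 k).rate)⁻¹ * Real.log (s.prior k) + ∑ j, ((𝓔 j).rate)⁻¹ * s.prior j

/-- The shift `⟨pₜ, gₜ - h'ₜ⟩` equals `⟨wₜ, ℓₜ - mₜ⟩`. The correction thus has the same form as the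
quadratic term of the experts' surrogate, whose reference point is `wₜ`. -/
theorem MasterState.baseLoss_sub_modHint (Λ : Set (Fin N → ℝ)) (s : MasterState 𝓔) (m ℓ : V)
    (k : Fin N) :
    s.baseLoss m ℓ k - s.modHint Λ m ℓ k
      = inner ℝ (s.baseDecision m k - s.decide Λ m) (ℓ - m) := by
  have h : inner ℝ (s.decide Λ m) (ℓ - m)
      = ∑ j, s.weights Λ m j * (s.baseLoss m ℓ j - s.hint m j) := by
    simp only [MasterState.decide, sum_inner, real_inner_smul_left, MasterState.baseLoss,
      MasterState.hint, inner_sub_right, mul_sub, Finset.sum_sub_distrib]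
  rw [inner_sub_left, h, MasterState.modHint, inner_sub_right, MasterState.baseLoss,
    MasterState.hint]
  ring

/-- An instance of `entropy_step`. With `a` the centred error, the threshold `1/64` gives `32ηa² ≤
|a|/2`, so the corrected error is at most `3/2 |a|`, and `9/4 ≤ 32` makes the correction large
enough. -/
theorem MasterState.round_le (hN : 0 < N) (hη : ∀ k, 0 < (𝓔 k).rate) (s : MasterState 𝓔)
    (hp : ∀ k, 0 < s.prior k) (m ℓ : V)
    (hsmall : ∀ k, (𝓔 k).rate * |inner ℝ (s.baseDecision m k
      - s.decide (stdSimplex ℝ (Fin N)) m) (ℓ - m)| ≤ 1 / 64) (k : Fin N) :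
    inner ℝ (s.decide (stdSimplex ℝ (Fin N)) m - s.baseDecision m k) ℓ
        - 32 * (𝓔 k).rate * inner ℝ (s.baseDecision m k
          - s.decide (stdSimplex ℝ (Fin N)) m) (ℓ - m) ^ 2
      ≤ s.potential k - (s.update (stdSimplex ℝ (Fin N)) m ℓ).potential k := by
  set Δ := stdSimplex ℝ (Fin N) with hΔ
  obtain ⟨c, hc, hcm⟩ := argminOn_entropy hN hη hp (s.modHint Δ m ℓ)
  obtain ⟨c', hc', hcm'⟩ := argminOn_entropy hN hη hp
    fun k => s.baseLoss m ℓ k + s.correction Δ m ℓ k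
  have hw : s.weights Δ m = _ := s.weights_eq Δ subset_rfl m ℓ
  have hdiff := s.baseLoss_sub_modHint Δ m ℓ
  have hbound : ∀ k, (𝓔 k).rate * |s.baseLoss m ℓ k + s.correction Δ m ℓ k - s.modHint Δ m ℓ k| ≤ 1
      ∧ (𝓔 k).rate * (s.baseLoss m ℓ k + s.correction Δ m ℓ k - s.modHint Δ m ℓ k) ^ 2
        ≤ s.correction Δ m ℓ k := by
    intro k
    have h1 := hsmall k
    rw [← hdiff] at h1
    set a := s.baseLoss m ℓ k - s.modHint Δ m ℓ k with ha
    set ε := (𝓔 k).rate with hε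
    have hε0 : 0 < ε := hη k
    have hcor : s.correction Δ m ℓ k = 32 * ε * a ^ 2 := rfl
    have hy : s.baseLoss m ℓ k + s.correction Δ m ℓ k - s.modHint Δ m ℓ k = a + 32 * ε * a ^ 2 := by
      rw [hcor, ha]; ring
    have h2 : 32 * ε * a ^ 2 ≤ 1 / 2 * |a| := by
      rw [← sq_abs a]
      nlinarith [mul_le_mul_of_nonneg_right h1 (abs_nonneg a)]
    have h3 : |a + 32 * ε * a ^ 2| ≤ 3 / 2 * |a| := by
      have := abs_add_le a (32 * ε * a ^ 2)
      rw [abs_of_nonneg (by positivity : 0 ≤ 32 * ε * a ^ 2)] at this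
      linarith
    rw [hy]
    refine ⟨?_, ?_⟩
    · have := mul_le_mul_of_nonneg_left h3 hε0.le
      linarith
    · have h4 : (a + 32 * ε * a ^ 2) ^ 2 ≤ 9 / 4 * a ^ 2 := by
        have := pow_le_pow_left₀ (abs_nonneg _) h3 2
        rw [sq_abs, mul_pow, sq_abs] at this
        linarith
      rw [hcor]
      nlinarith [mul_le_mul_of_nonneg_left h4 hε0.le, mul_nonneg hε0.le (sq_nonneg a)]
  have h := entropy_step hη hp (q := s.weights Δ m) (p' := (s.update Δ m ℓ).prior)
    (fun k => by rw [hw]; exact hc k) (by rw [hw]; exact hcm.2) hc' hcm'.2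
    (fun k => (hbound k).1) (fun k => (hbound k).2) k
  have hdec : inner ℝ (s.decide Δ m) ℓ = ∑ j, s.weights Δ m j * s.baseLoss m ℓ j := by
    simp only [MasterState.decide, sum_inner, real_inner_smul_left, MasterState.baseLoss]
  have hcor : s.correction Δ m ℓ k = 32 * (𝓔 k).rate
      * inner ℝ (s.baseDecision m k - s.decide Δ m) (ℓ - m) ^ 2 := by
    rw [← hdiff]; rfl
  rw [inner_sub_left, hdec, ← hcor]
  exact h

end MasterRegret

/-! ### The master with MetaGrad experts -/

section MetaGradMaster

variable {d : ℕ}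

/-- No condition on the reference points is needed. This avoids a circle: the master lies in `K`
because the experts do, and their regret bound then requires the master to lie in `K`. -/
theorem IsRun.decide_mem {K : Set (EuclideanSpace ℝ (Fin d))} (hK : IsCompact K)
    (hc : Convex ℝ K) (hne : K.Nonempty) {η : ℝ} {m ℓ wbar : ℕ → EuclideanSpace ℝ (Fin d)}
    {s : ℕ → MetaGradState d} (hs : IsRun K η m ℓ wbar s) (t : ℕ) :
    (s t).decide K η (m t) ∈ K := by
  have hsymm : ∀ t, (s t).gram.IsSymm := by
    intro t
    induction t with
    | zero => rw [hs.zero]; exact Matrix.isSymm_zero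
    | succ t ih => rw [hs.succ]; exact ih.add (outer_isSymm _)
  exact (prox_quadReg hK hc hne (((Matrix.isSymm_one.smul 8).add (hsymm t)).smul η)
    (m t) (s t).center).1

theorem sum_half_pow_le (N : ℕ) : ∑ k : Fin N, (1 / 2 : ℝ) ^ (k.val + 1) ≤ 1 := by
  rw [Fin.sum_univ_eq_sum_range (fun k => (1 / 2 : ℝ) ^ (k + 1))]
  have : ∀ n : ℕ, ∑ k ∈ Finset.range n, (1 / 2 : ℝ) ^ (k + 1) = 1 - (1 / 2) ^ n := by
    intro n
    induction n with
    | zero => simp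
    | succ n ih => rw [Finset.sum_range_succ, ih]; ring
  rw [this]
  have : (0 : ℝ) ≤ (1 / 2) ^ N := by positivity
  linarith

variable {K : Set (EuclideanSpace ℝ (Fin d))} {D : ℝ} {T : ℕ}

theorem rate_pos (hD : 0 < D) (k : Fin (numExperts D T)) : 0 < (expertSet K D T k).rate := by
  change 0 < 1 / (64 * D * 2 ^ (k.val + 1))
  positivity

theorem rate_eq (hD : 0 < D) (k : Fin (numExperts D T)) :
    (expertSet K D T k).rate = 1 / (64 * D) * (1 / 2) ^ (k.val + 1) := by
  change 1 / (64 * D * 2 ^ (k.val + 1)) = _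
  rw [one_div_pow]
  field_simp

theorem sum_rate_le (hD : 0 < D) : ∑ k, (expertSet K D T k).rate ≤ 1 / (64 * D) := by
  simp only [rate_eq hD, ← Finset.mul_sum]
  exact mul_le_of_le_one_right (by positivity) (sum_half_pow_le _)

theorem sum_rate_sq_le (hD : 0 < D) :
    ∑ k, (expertSet K D T k).rate ^ 2 ≤ (1 / (64 * D)) ^ 2 := by
  refine (Finset.sum_sq_le_sq_sum_of_nonneg fun k _ => (rate_pos hD k).le).trans ?_
  exact pow_le_pow_left₀ (Finset.sum_nonneg fun k _ => (rate_pos hD k).le) (sum_rate_le hD) 2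

theorem le_sum_rate_sq (hD : 0 < D) (hN : 0 < numExperts D T) :
    (1 / (128 * D)) ^ 2 ≤ ∑ k, (expertSet K D T k).rate ^ 2 := by
  refine le_trans (le_of_eq ?_) (Finset.single_le_sum
    (fun k _ => sq_nonneg (expertSet K D T k).rate) (Finset.mem_univ ⟨0, hN⟩))
  rw [rate_eq hD]
  field_simp
  norm_num

/-- The normalizer `∑ ηⱼ²` lies between `η₁²` and `(∑ ηⱼ)²`. The upper bound gives `log (1/p'₁,ₖ) ≤
2 log y`; the lower bound gives `∑ ηⱼ⁻¹ p'₁,ⱼ = ∑ ηⱼ / ∑ ηⱼ² ≤ 256D`, whatever the number of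
experts. -/
theorem potential_init_le (hD : 0 < D) (k : Fin (numExperts D T)) :
    (MasterState.init (expertSet K D T)).potential k
      ≤ 64 * D * 2 ^ (k.val + 1) * (2 * Real.log (2 ^ (k.val + 1))) + 256 * D := by
  have hN : 0 < numExperts D T := k.pos
  have hQ := le_sum_rate_sq (K := K) hD hN
  have hQ' := sum_rate_sq_le (K := K) (T := T) hD
  have hS := sum_rate_le (K := K) (T := T) hD
  set Q := ∑ j, (expertSet K D T j).rate ^ 2 with hQdef
  have hQ0 : 0 < Q := lt_of_lt_of_le (by positivity) hQ
  set y : ℝ := 2 ^ (k.val + 1) with hy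
  have hy0 : 0 < y := by positivity
  have hr : (expertSet K D T k).rate = 1 / (64 * D * y) := rfl
  have h1 : -((expertSet K D T k).rate)⁻¹ * Real.log ((expertSet K D T k).rate ^ 2 / Q)
      ≤ 64 * D * y * (2 * Real.log y) := by
    have h2 : -Real.log ((expertSet K D T k).rate ^ 2 / Q) ≤ 2 * Real.log y := by
      have h3 : (2 : ℝ) * Real.log y = Real.log (y ^ 2) := by
        exact_mod_cast (Real.log_pow y 2).symm
      rw [← Real.log_inv, inv_div, h3]
      refine Real.log_le_log (by have := rate_pos (K := K) hD k; positivity) ?_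
      rw [div_le_iff₀ (by have := rate_pos (K := K) hD k; positivity), hr]
      refine hQ'.trans (le_of_eq ?_)
      field_simp
    rw [hr, one_div, inv_inv] at *
    have := mul_le_mul_of_nonneg_left h2 (by positivity : 0 ≤ 64 * D * y)
    linarith
  have h2 : ∑ j, ((expertSet K D T j).rate)⁻¹ * ((expertSet K D T j).rate ^ 2 / Q)
      ≤ 256 * D := by
    have h3 : ∀ j, ((expertSet K D T j).rate)⁻¹ * ((expertSet K D T j).rate ^ 2 / Q)
        = (expertSet K D T j).rate / Q := fun j => by
      have := (rate_pos (K := K) hD j).ne'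
      field_simp
    simp only [h3, ← Finset.sum_div]
    rw [div_le_iff₀ hQ0]
    refine hS.trans (le_trans (le_of_eq ?_) (mul_le_mul_of_nonneg_left hQ (by positivity)))
    field_simp
    norm_num
  exact add_le_add h1 h2

variable (m ℓ : ℕ → EuclideanSpace ℝ (Fin d))

/-- The states of the master. -/
abbrev metaState (K : Set (EuclideanSpace ℝ (Fin d))) (D : ℝ) (T : ℕ) (t : ℕ) :
    MasterState (expertSet K D T) :=
  masterState (expertSet K D T) (fun _ => stdSimplex ℝ (Fin (numExperts D T))) m ℓ t

theorem metaState_isRun (k : Fin (numExperts D T)) :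
    IsRun K (4 * (1 / (64 * D * 2 ^ (k.val + 1)))) m ℓ (metaGradMaster K D T m ℓ)
      (fun t => (metaState m ℓ K D T t).base k) where
  zero := rfl
  succ _ := rfl

theorem metaState_prior (hD : 0 < D) (hN : 0 < numExperts D T) (t : ℕ) :
    (∀ k, 0 < (metaState m ℓ K D T t).prior k) ∧
      (metaState m ℓ K D T t).prior ∈ stdSimplex ℝ (Fin (numExperts D T)) := by
  induction t with
  | zero =>
    have hQ := lt_of_lt_of_le (by positivity) (le_sum_rate_sq (K := K) hD hN)
    have hp : ∀ k, 0 < (metaState m ℓ K D T 0).prior k :=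
      fun k => div_pos (pow_pos (rate_pos hD k) 2) hQ
    refine ⟨hp, fun k => (hp k).le, ?_⟩
    change ∑ k, (expertSet K D T k).rate ^ 2 / _ = 1
    rw [← Finset.sum_div, div_self hQ.ne']
  | succ t ih =>
    exact ⟨MasterState.update_prior_pos hN (rate_pos hD) _ ih.1 _ _,
      MasterState.update_prior_mem hN (rate_pos hD) _ ih.1 _ _⟩

theorem metaGradMaster_mem (hK : IsCompact K) (hc : Convex ℝ K) (hne : K.Nonempty) (hD : 0 < D)
    (hN : 0 < numExperts D T) (t : ℕ) : metaGradMaster K D T m ℓ t ∈ K := by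
  have hw := (metaState m ℓ K D T t).weights_mem hN (rate_pos hD) (metaState_prior m ℓ hD hN t).1
    (m t)
  exact hc.sum_mem (fun k _ => hw.1 k) hw.2
    fun k _ => (metaState_isRun m ℓ k).decide_mem hK hc hne t

theorem metaState_potential_nonneg (hD : 0 < D) (k : Fin (numExperts D T)) (t : ℕ) :
    0 ≤ (metaState m ℓ K D T t).potential k := by
  obtain ⟨hp, hm⟩ := metaState_prior (K := K) m ℓ hD k.pos t
  have h1 : (metaState m ℓ K D T t).prior k ≤ 1 := by
    rw [← hm.2]
    exact Finset.single_le_sum (fun j _ => (hp j).le) (Finset.mem_univ k)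
  have h2 := Real.log_nonpos (hp k).le h1
  have h3 := inv_pos.2 (rate_pos (K := K) hD k)
  refine add_nonneg (by nlinarith) (Finset.sum_nonneg fun j _ => ?_)
  exact mul_nonneg (inv_nonneg.2 (rate_pos hD j).le) (hp j).le

/-- The regret for a fixed choice of expert. -/
theorem regret_le_of_expert (hK : IsCompact K) (hc : Convex ℝ K) (hKD : ∀ w ∈ K, ‖w‖ ≤ D)
    (hD : 0 < D) (hℓ : ∀ t < T, ‖ℓ t - m t‖ ≤ 1) {u : EuclideanSpace ℝ (Fin d)} (hu : u ∈ K)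
    (k : Fin (numExperts D T)) {y : ℝ} (hy : y = 2 ^ (k.val + 1)) :
    regret T (metaGradMaster K D T m ℓ) ℓ u
      ≤ 128 * (D * y) * Real.log y + 257 * D
        + 68 * (D * y) * (errorRank T m ℓ * Real.log (1 + 9 * T / 8))
        + (∑ t ∈ Finset.range T,
            inner ℝ (u - metaGradMaster K D T m ℓ t) (ℓ t - m t) ^ 2) / (D * y) := by
  have hN : 0 < numExperts D T := k.pos
  have hy2 : 2 ≤ y := by
    rw [hy, pow_succ]
    have : (1 : ℝ) ≤ 2 ^ k.val := one_le_pow₀ (by norm_num)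
    linarith
  have hy0 : 0 < y := by linarith
  have hmem := metaGradMaster_mem (T := T) m ℓ hK hc ⟨u, hu⟩ hD hN
  have hbase := fun j => (metaState_isRun (K := K) (D := D) (T := T) m ℓ j).decide_mem hK hc ⟨u, hu⟩
  set w := metaGradMaster K D T m ℓ with hw
  set x : ℕ → EuclideanSpace ℝ (Fin d) :=
    fun t => (metaState m ℓ K D T t).baseDecision (m t) k with hx
  have hround : ∀ t ∈ Finset.range T,
      inner ℝ (w t - x t) (ℓ t) - 32 * (1 / (64 * D * y)) * inner ℝ (x t - w t) (ℓ t - m t) ^ 2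
        ≤ (metaState m ℓ K D T t).potential k - (metaState m ℓ K D T (t + 1)).potential k := by
    intro t ht
    rw [Finset.mem_range] at ht
    have h := (metaState m ℓ K D T t).round_le hN (rate_pos hD) (metaState_prior m ℓ hD hN t).1
      (m t) (ℓ t) ?_ k
    · rw [hy]
      exact h
    · intro j
      have h1 : |inner ℝ ((metaState m ℓ K D T t).baseDecision (m t) j - w t) (ℓ t - m t)|
          ≤ 2 * D := by
        refine (abs_real_inner_le_norm _ _).trans ?_
        have h2 := norm_sub_le ((metaState m ℓ K D T t).baseDecision (m t) j) (w t)
        have h3 := hKD _ (hbase j t)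
        have h4 := hKD _ (hmem t)
        have h5 : ‖(metaState m ℓ K D T t).baseDecision (m t) j - w t‖ ≤ 2 * D := by
          refine h2.trans ?_
          rw [two_mul]
          exact add_le_add h3 h4
        exact (mul_le_of_le_one_right (norm_nonneg _) (hℓ t ht)).trans h5
      have h2 : (expertSet K D T j).rate ≤ 1 / (128 * D) := by
        rw [rate_eq hD]
        have : ((1 : ℝ) / 2) ^ (j.val + 1) ≤ 1 / 2 := by
          rw [pow_succ]
          have : ((1 : ℝ) / 2) ^ j.val ≤ 1 := pow_le_one₀ (by norm_num) (by norm_num)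
          linarith
        calc _ ≤ 1 / (64 * D) * (1 / 2) := mul_le_mul_of_nonneg_left this (by positivity)
          _ = 1 / (128 * D) := by field_simp; norm_num
      refine (mul_le_mul h2 h1 (abs_nonneg _) (by positivity)).trans (le_of_eq ?_)
      field_simp
      norm_num
  have hmaster := Finset.sum_le_sum hround
  rw [Finset.sum_range_sub' (fun t => (metaState m ℓ K D T t).potential k)] at hmaster
  -- Tight for the first expert, `y = 2`: this is why the exponents start at `1`.
  have hrate : 32 * (4 * (1 / (64 * D * y))) * D ≤ 1 := by
    have : 32 * (4 * (1 / (64 * D * y))) * D = 2 / y := by field_simp; norm_num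
    rw [this, div_le_one hy0]
    exact hy2
  have hrun := metaState_isRun (K := K) (D := D) (T := T) m ℓ k
  rw [← hy] at hrun
  have hexpert := hrun.regret_le hK hc hKD (by positivity) hrate hℓ (fun t _ => hmem t) hu
  have hexpert' : ∑ t ∈ Finset.range T, (inner ℝ (x t - u) (ℓ t)
        + 16 * (4 * (1 / (64 * D * y))) * inner ℝ (x t - w t) (ℓ t - m t) ^ 2
        - 16 * (4 * (1 / (64 * D * y))) * inner ℝ (u - w t) (ℓ t - m t) ^ 2)
      ≤ 4 * (4 * (1 / (64 * D * y))) * D ^ 2 + 17 / 4 * ((4 * (1 / (64 * D * y)))⁻¹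
        * (errorRank T m ℓ * Real.log (1 + 9 * T / 8))) := by
    subst hy
    exact hexpert
  have hinit := potential_init_le (K := K) hD k
  rw [← hy] at hinit
  have hlast := metaState_potential_nonneg (K := K) m ℓ hD k T
  -- The factor `4` between the two learning rates turns `16` into `64`, which exceeds the master's
  -- `32`; the surplus in `⟨x - w, ℓ - m⟩²` is dropped.
  have hsum : regret T w ℓ u ≤ ∑ t ∈ Finset.range T,
        (inner ℝ (w t - x t) (ℓ t)
          - 32 * (1 / (64 * D * y)) * inner ℝ (x t - w t) (ℓ t - m t) ^ 2)
      + ∑ t ∈ Finset.range T, (inner ℝ (x t - u) (ℓ t)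
        + 16 * (4 * (1 / (64 * D * y))) * inner ℝ (x t - w t) (ℓ t - m t) ^ 2
        - 16 * (4 * (1 / (64 * D * y))) * inner ℝ (u - w t) (ℓ t - m t) ^ 2)
      + (∑ t ∈ Finset.range T, inner ℝ (u - w t) (ℓ t - m t) ^ 2) / (D * y) := by
    rw [Finset.sum_div, ← Finset.sum_add_distrib, ← Finset.sum_add_distrib, regret]
    refine Finset.sum_le_sum fun t _ => ?_
    have h1 : inner ℝ (w t - u) (ℓ t) = inner ℝ (w t - x t) (ℓ t) + inner ℝ (x t - u) (ℓ t) := by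
      rw [← inner_add_left]; congr 1; abel
    have h2 : inner ℝ (u - w t) (ℓ t - m t) ^ 2 / (D * y)
        = 16 * (4 * (1 / (64 * D * y))) * inner ℝ (u - w t) (ℓ t - m t) ^ 2 := by
      field_simp
      ring
    have h3 : 0 ≤ 1 / (64 * D * y) * inner ℝ (x t - w t) (ℓ t - m t) ^ 2 := by positivity
    rw [h1, h2]
    linarith
  have hη1 : 4 * (4 * (1 / (64 * D * y))) * D ^ 2 ≤ D := by
    have : 4 * (4 * (1 / (64 * D * y))) * D ^ 2 = D * (1 / (4 * y)) := by field_simp; norm_num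
    rw [this]
    refine mul_le_of_le_one_right hD.le ?_
    rw [div_le_one (by positivity)]
    linarith
  have hη2 : (4 * (1 / (64 * D * y)))⁻¹ = 16 * (D * y) := by field_simp; norm_num
  rw [hη2] at hexpert'
  have h0 : metaState m ℓ K D T 0 = MasterState.init (expertSet K D T) := rfl
  rw [h0] at hmaster
  linarith

/-! ### Tuning: the choice of the expert -/

theorem log_one_add_le {T : ℕ} (hT : 1 ≤ T) :
    Real.log (1 + 9 * T / 8) ≤ 1 + Real.log T := by
  have hT' : (1 : ℝ) ≤ T := by exact_mod_cast hT
  have h1 : (1 : ℝ) + 9 * T / 8 ≤ Real.exp 1 * T := by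
    nlinarith [Real.exp_one_gt_d9]
  refine (Real.log_le_log (by positivity) h1).trans (le_of_eq ?_)
  rw [Real.log_mul (Real.exp_pos _).ne' (by positivity), Real.log_exp]

/-- There is an expert with nearly optimal rate. -/
theorem exists_expert (hD : 0 < D) (hDT : 1 ≤ D * Real.sqrt T) (hT : 1 ≤ T) {r S : ℝ}
    (hr : 1 ≤ r) (hS : S ≤ (2 * D) ^ 2 * T) :
    ∃ k : Fin (numExperts D T), ∃ y : ℝ, y = 2 ^ (k.val + 1) ∧
      Real.sqrt S ≤ D * y * Real.sqrt r ∧ D * y * r ≤ 2 * (r * D + Real.sqrt (r * S)) ∧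
      y ≤ 4 * Real.sqrt T := by
  have hT' : (1 : ℝ) ≤ T := by exact_mod_cast hT
  have hsT : 1 ≤ Real.sqrt T := Real.one_le_sqrt.2 hT'
  have hsr : 1 ≤ Real.sqrt r := Real.one_le_sqrt.2 hr
  have hsS : Real.sqrt S ≤ 2 * D * Real.sqrt T := by
    refine (Real.sqrt_le_sqrt hS).trans (le_of_eq ?_)
    rw [Real.sqrt_mul (sq_nonneg _), Real.sqrt_sq (by positivity)]
  have hDT' : Real.sqrt T ≤ D * T := by
    have h := Real.sq_sqrt (by positivity : (0 : ℝ) ≤ T)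
    calc Real.sqrt T ≤ (D * Real.sqrt T) * Real.sqrt T := le_mul_of_one_le_left (by positivity) hDT
      _ = D * T := by rw [mul_assoc, ← sq, h]
  have hpow : 2 * D * T ≤ 2 ^ numExperts D T := by
    have h1 : Real.logb 2 (2 * D * T) ≤ (numExperts D T : ℝ) := Nat.le_ceil _
    rw [Real.logb_le_iff_le_rpow (by norm_num) (by positivity), Real.rpow_natCast] at h1
    exact h1
  have hN : 0 < numExperts D T := by
    rw [numExperts, Nat.ceil_pos]
    exact Real.logb_pos (by norm_num) (by linarith)
  -- The grid reaches far enough: `√S ≤ 2D√T ≤ 2D · DT`, where the last inequality is the assumption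
  -- `D√T ≥ 1`.
  have hlast : Real.sqrt S ≤ D * 2 ^ (numExperts D T - 1 + 1) * Real.sqrt r := by
    rw [Nat.sub_add_cancel hN]
    calc Real.sqrt S ≤ 2 * D * Real.sqrt T := hsS
      _ ≤ D * 2 ^ numExperts D T := by nlinarith
      _ ≤ _ := le_mul_of_one_le_right (by positivity) hsr
  -- Take the least admissible `y`. Either `y = 2`, or `y/2` fails; that failure yields both upper
  -- bounds on `y`.
  obtain ⟨κ, hκ, hκmin, hκle⟩ : ∃ κ : ℕ, Real.sqrt S ≤ D * 2 ^ (κ + 1) * Real.sqrt r ∧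
      (∀ j < κ, ¬ Real.sqrt S ≤ D * 2 ^ (j + 1) * Real.sqrt r) ∧ κ ≤ numExperts D T - 1 := by
    classical
    have hex : ∃ κ : ℕ, Real.sqrt S ≤ D * 2 ^ (κ + 1) * Real.sqrt r := ⟨_, hlast⟩
    exact ⟨Nat.find hex, Nat.find_spec hex, fun _ => Nat.find_min hex, Nat.find_min' hex hlast⟩
  refine ⟨⟨κ, by omega⟩, _, rfl, hκ, ?_⟩
  rw [Real.sqrt_mul (by linarith)]
  have hrr : Real.sqrt r * Real.sqrt r = r := Real.mul_self_sqrt (by linarith)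
  rcases Nat.eq_zero_or_pos κ with h0 | h0
  · simp only [h0]
    constructor
    · have : 0 ≤ Real.sqrt r * Real.sqrt S := by positivity
      norm_num
      linarith
    · norm_num
      linarith
  · have hmin := hκmin (κ - 1) (by omega)
    rw [not_le, Nat.sub_add_cancel h0] at hmin
    simp only [pow_succ]
    set z : ℝ := 2 ^ κ with hz
    have hz0 : 0 < z := by positivity
    constructor
    · have := mul_le_mul_of_nonneg_left hmin.le (Real.sqrt_nonneg r)
      have h2 : Real.sqrt r * (D * z * Real.sqrt r) = D * z * r := by linear_combination D * z * hrr
      rw [h2] at this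
      have h3 : 0 ≤ r * D := by positivity
      linarith
    · have h1 : D * z ≤ D * (2 * Real.sqrt T) := by
        have := le_mul_of_one_le_right (by positivity : 0 ≤ D * z) hsr
        linarith
      have := le_of_mul_le_mul_left h1 hD
      linarith

end MetaGradMaster

end OLO

end

theorem mainTheorem8 :
    ∃ C : ℝ, 0 < C ∧
      ∀ (d T : ℕ) (D : ℝ) (K : Set (EuclideanSpace ℝ (Fin d)))
        (m ℓ : ℕ → EuclideanSpace ℝ (Fin d)),
        IsCompact K → Convex ℝ K → (∀ w ∈ K, ‖w‖ ≤ D) →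
        (∀ t < T, ‖ℓ t - m t‖ ≤ 1) →
        1 ≤ D * Real.sqrt T →
        1 ≤ OLO.errorRank T m ℓ →
        ∀ u ∈ K,
          OLO.regret T (OLO.metaGradMaster K D T m ℓ) ℓ u ≤
            C * (1 + Real.log T) *
              (OLO.errorRank T m ℓ * D +
                Real.sqrt (OLO.errorRank T m ℓ *
                  ∑ t ∈ Finset.range T,
                    inner ℝ (u - OLO.metaGradMaster K D T m ℓ t) (ℓ t - m t) ^ 2)) := by
  -- The terms bounded below add up to `128·4 + 257 + 68·2 + 1 = 906`.
  refine ⟨1000, by norm_num, fun d T D K m ℓ hK hc hKD hℓ hDT hrank u hu => ?_⟩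
  have hsT : 0 < Real.sqrt T := by
    refine (Real.sqrt_nonneg _).lt_of_ne' fun h => ?_
    rw [h, mul_zero] at hDT
    linarith
  have hD : 0 < D := pos_of_mul_pos_left (by linarith) hsT.le
  have hT : 1 ≤ T := by
    have : (0 : ℝ) < T := Real.sqrt_pos.1 hsT
    exact_mod_cast this
  have hT' : (1 : ℝ) ≤ T := by exact_mod_cast hT
  have hr : (1 : ℝ) ≤ OLO.errorRank T m ℓ := by exact_mod_cast hrank
  have hN : 0 < OLO.numExperts D T :=
    (OLO.exists_expert hD hDT hT le_rfl (S := 0) (by positivity)).choose.pos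
  have hmem := OLO.metaGradMaster_mem (T := T) m ℓ hK hc ⟨u, hu⟩ hD hN
  set w := OLO.metaGradMaster K D T m ℓ with hw
  set S := ∑ t ∈ Finset.range T, inner ℝ (u - w t) (ℓ t - m t) ^ 2 with hSdef
  have hS0 : 0 ≤ S := Finset.sum_nonneg fun t _ => sq_nonneg _
  have hS : S ≤ (2 * D) ^ 2 * T := by
    calc S ≤ ∑ t ∈ Finset.range T, (2 * D) ^ 2 := by
          refine Finset.sum_le_sum fun t ht => ?_
          rw [← sq_abs]
          refine pow_le_pow_left₀ (abs_nonneg _) ((abs_real_inner_le_norm _ _).trans ?_) 2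
          refine (mul_le_of_le_one_right (norm_nonneg _) (hℓ t (Finset.mem_range.1 ht))).trans ?_
          refine (norm_sub_le _ _).trans ?_
          linarith [hKD u hu, hKD _ (hmem t)]
      _ = (2 * D) ^ 2 * T := by simp [mul_comm]
  set r : ℝ := ((OLO.errorRank T m ℓ : ℕ) : ℝ) with hrdef
  obtain ⟨k, y, hy, h1, h2, h3⟩ := OLO.exists_expert hD hDT hT hr hS
  have hreg := OLO.regret_le_of_expert m ℓ hK hc hKD hD hℓ hu k hy
  rw [← hw, ← hSdef, ← hrdef] at hreg
  have hy0 : 0 < y := by rw [hy]; positivity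
  have hlogT : 0 ≤ Real.log T := Real.log_nonneg hT'
  -- Uses `y ≤ 4√T`; the size of the grid alone would bring in `log D`.
  have hlogy : Real.log y ≤ 2 * (1 + Real.log T) := by
    refine (Real.log_le_log hy0 h3).trans ?_
    have h4 : Real.log 4 = 2 * Real.log 2 := by
      rw [show (4 : ℝ) = 2 ^ 2 by norm_num, Real.log_pow]; norm_num
    rw [Real.log_mul (by norm_num) hsT.ne', Real.log_sqrt (by positivity), h4]
    linarith [Real.log_two_lt_d9]
  have hdiv : S / (D * y) ≤ Real.sqrt (r * S) := by
    rw [div_le_iff₀ (by positivity), Real.sqrt_mul (by linarith)]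
    have := mul_le_mul_of_nonneg_left h1 (Real.sqrt_nonneg S)
    rw [Real.mul_self_sqrt hS0] at this
    linarith
  have hL := OLO.log_one_add_le hT
  set L := 1 + Real.log T with hLdef
  have hL1 : 1 ≤ L := by linarith
  set R := r * D + Real.sqrt (r * S) with hR
  have hsq : 0 ≤ Real.sqrt (r * S) := Real.sqrt_nonneg _
  have hDR : D ≤ R := by nlinarith
  have hDy : D * y ≤ 2 * R := (le_mul_of_one_le_right (by positivity) hr).trans h2
  have hR0 : 0 ≤ R := hD.le.trans hDR
  have hRL : R ≤ R * L := le_mul_of_one_le_right hR0 hL1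
  have t1 : D * y * Real.log y ≤ 4 * (R * L) := by
    calc D * y * Real.log y ≤ D * y * (2 * L) := mul_le_mul_of_nonneg_left hlogy (by positivity)
      _ ≤ 2 * R * (2 * L) := mul_le_mul_of_nonneg_right hDy (by positivity)
      _ = 4 * (R * L) := by ring
  have t2 : D * y * (r * Real.log (1 + 9 * T / 8)) ≤ 2 * (R * L) := by
    calc D * y * (r * Real.log (1 + 9 * T / 8)) = D * y * r * Real.log (1 + 9 * T / 8) := by ring
      _ ≤ D * y * r * L := mul_le_mul_of_nonneg_left hL (by positivity)
      _ ≤ 2 * R * L := mul_le_mul_of_nonneg_right h2 (by positivity)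
      _ = 2 * (R * L) := by ring
  have t3 : S / (D * y) ≤ R := hdiv.trans (le_add_of_nonneg_left (by positivity))
  have hfin : 1000 * L * R = 1000 * (R * L) := by ring
  rw [hfin]
  linarith [mul_nonneg hR0 (by linarith : (0 : ℝ) ≤ L)]
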